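/- Let $\mathcal D$ be a subgaussian probability distribution on $\mathbb R$ (i.e. for some $L>0$, $\mathcal D\{|t|\ge Lu\}\le 2e^{-u^2/2}$ for all $u\ge 1$) with mean $0$ and variance $1$, and let $\varepsilon_{T^\perp},\varepsilon_T\in(0,1]$. Then there exist constants $0<\mu<1$, $\kappa_0>1$, $c>0$ and $B_0>0$ (depending only on $\mathcal D,\varepsilon_{T^\perp},\varepsilon_T$, not on $n$, $m$) such that, for all sufficiently large $n$, all $m\ge\kappa_0 n$, and every fixed $\mu$-flat vector $x_0\in\mathbb R^n$ (i.e. $\|x_0\|_\infty\le\mu\|x_0\|_2$), the following holds. Let $a_1,\dots,a_m\in\mathbb R^n$ be independent random vectors with independent entries of law $\mathcal D$. Let $\mathcal A:\mathbb R^{n\times n}\to\mathbb R^m$, $\mathcal A(X)=(\operatorname{Tr}(a_ia_i^TX))_{i=1}^m$, and let $\mathcal A^*$ be its adjoint with respect to the Frobenius and Euclidean inner products. Let $T=\{xx_0^T+x_0x^T : x\in\mathbb R^n\}$, let $T^\perp$ be its orthogonal complement in $\mathbb R^{n\times n}$ for the Frobenius inner product, and for a matrix $Z$ write $Z_T$,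 $Z_{T^\perp}$ for its orthogonal projections onto $T$, $T^\perp$. Then, with probability at least $1-e^{-cm}$ over the choice of the $a_i$, there exists a matrix $Y\in\mathbb R^{n\times n}$ of the form $Y=\mathcal A^*(\lambda)$ with $\lambda\in\mathbb R^m$, $\|\lambda\|_\infty\le B_0/m$, such that $$\|Y_{T^\perp}+2I_{T^\perp}\|\le\varepsilon_{T^\perp},\qquad \|Y_T\|_F\le\varepsilon_T,$$ where $I$ is the identity matrix, $\|\cdot\|$ is the operator (spectral) norm and $\|\cdot\|_F$ the Frobenius norm. -/

import Mathlib

open MeasureTheory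

noncomputable section

attribute [local instance] Matrix.frobeniusNormedAddCommGroup Matrix.frobeniusNormedSpace

/-- The space of real `n × n` matrices with the inner product `⟪X, Y⟫ = Tr(Xᵀ Y)`,
whose norm is the Frobenius norm. -/
@[reducible]
def frobeniusInnerProductSpace (n : ℕ) : InnerProductSpace ℝ (Matrix (Fin n) (Fin n) ℝ) where
  inner X Y := (X.transpose * Y).trace
  norm_sq_eq_re_inner X := by
    rw [Matrix.frobenius_norm_def, ← Real.sqrt_eq_rpow, Real.sq_sqrt (by positivity)]
    simp [Matrix.trace, Matrix.mul_apply, ← sq]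
    exact Finset.sum_comm
  conj_inner_symm X Y := by
    simp only [conj_trivial]
    rw [← Matrix.trace_transpose, Matrix.transpose_mul, Matrix.transpose_transpose]
  add_left X Y Z := by
    rw [Matrix.transpose_add, Matrix.add_mul, Matrix.trace_add]
  smul_left X Y r := by
    simp [Matrix.trace_smul]

attribute [local instance] frobeniusInnerProductSpace

/-- The law `D` on `ℝ` is subgaussian with parameter `L`. -/
def IsSubgaussianWith (D : Measure ℝ) (L : ℝ) : Prop :=
  0 < L ∧ ∀ u : ℝ, 1 ≤ u → D.real {t : ℝ | L * u ≤ |t|} ≤ 2 * Real.exp (-u ^ 2 / 2)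

/-- `x` is `μ`-flat: `‖x‖_∞ ≤ μ ‖x‖_2`.  (The norm of `Fin n → ℝ` is the sup norm.) -/
def IsFlat {n : ℕ} (μ : ℝ) (x : Fin n → ℝ) : Prop :=
  ‖x‖ ≤ μ * ‖WithLp.toLp 2 x‖

/-- The sampling operator `X ↦ (Tr(aᵢ aᵢᵀ X))ᵢ` of the measurement vectors `a₁, …, aₘ`. -/
def samplingOp {n m : ℕ} (a : Fin m → Fin n → ℝ) :
    Matrix (Fin n) (Fin n) ℝ →ₗ[ℝ] EuclideanSpace ℝ (Fin m) where
  toFun X := WithLp.toLp 2 fun i => (Matrix.vecMulVec (a i) (a i) * X).trace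
  map_add' X Y := by
    ext i
    simp [Matrix.mul_add]
  map_smul' r X := by
    ext i
    simp

/-- The tangent space `T(x₀) = {x x₀ᵀ + x₀ xᵀ : x ∈ ℝⁿ}`. -/
def tangentSpaceAt {n : ℕ} (x₀ : Fin n → ℝ) : Submodule ℝ (Matrix (Fin n) (Fin n) ℝ) where
  carrier := {X | ∃ x : Fin n → ℝ, X = Matrix.vecMulVec x x₀ + Matrix.vecMulVec x₀ x}
  add_mem' := by
    rintro _ _ ⟨x, rfl⟩ ⟨y, rfl⟩
    refine ⟨x + y, ?_⟩
    rw [Matrix.add_vecMulVec, Matrix.vecMulVec_add]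
    abel
  zero_mem' := ⟨0, by simp⟩
  smul_mem' := by
    rintro r _ ⟨x, rfl⟩
    refine ⟨r • x, ?_⟩
    rw [Matrix.smul_vecMulVec, Matrix.vecMulVec_smul, smul_add]

/-- The orthogonal projection of a matrix onto a subspace of `ℝ^{n×n}`, with respect to the
Frobenius inner product. -/
def matProj {n : ℕ} (T : Submodule ℝ (Matrix (Fin n) (Fin n) ℝ)) (Y : Matrix (Fin n) (Fin n) ℝ) :
    Matrix (Fin n) (Fin n) ℝ :=
  T.starProjection Y

/-- The Frobenius norm. -/
def frobNorm {n : ℕ} (M : Matrix (Fin n) (Fin n) ℝ) : ℝ := ‖M‖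

/-- The operator norm of a matrix acting on Euclidean space. -/
def spectralNorm₂ {n : ℕ} (M : Matrix (Fin n) (Fin n) ℝ) : ℝ :=
  ‖Matrix.toEuclideanCLM (n := Fin n) (𝕜 := ℝ) M‖

/-- `Y` is a dual certificate at `x₀` for the measurement vectors `a`:  it has the form `𝒜*(l)`
with `‖l‖_∞ ≤ B / m`, `‖Y_{T⊥} + 2 I_{T⊥}‖ ≤ εperp` and `‖Y_T‖_F ≤ εT`, where `T = T(x₀)`. -/
def IsDualCertificate {n m : ℕ} (a : Fin m → Fin n → ℝ) (x₀ : Fin n → ℝ) (B εperp εT : ℝ)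
    (Y : Matrix (Fin n) (Fin n) ℝ) : Prop :=
  (∃ l : Fin m → ℝ, ‖l‖ ≤ B / m ∧ Y = (samplingOp a).adjoint (WithLp.toLp 2 l)) ∧
  spectralNorm₂ (matProj (tangentSpaceAt x₀)ᗮ Y + (2 : ℝ) • matProj (tangentSpaceAt x₀)ᗮ 1)
    ≤ εperp ∧
  frobNorm (matProj (tangentSpaceAt x₀) Y) ≤ εT

/-- The joint law of `m` independent vectors in `ℝⁿ` with independent entries of law `D`. -/
def measurementLaw (D : Measure ℝ) (n m : ℕ) : Measure (Fin m → Fin n → ℝ) :=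
  Measure.pi fun _ => Measure.pi fun _ => D

end

-- Rescale `x₀` to a unit vector `x` (or take `x = 0` if `x₀ = 0`). The certificate is explicit: `Y
-- = m⁻¹ ∑ w(aᵢ) aᵢ aᵢᵀ` with `w(a) = -2 exp(|x|²/2) cos⟨x, a⟩`. For a Gaussian vector, `E cos⟨x, a⟩
-- a aᵀ = exp(-|x|²/2) (I - x xᵀ)`, so `Y` would have mean exactly `-2 (I - x xᵀ) = -2 I_{T⊥}`. The
-- weight is bounded, so `‖λ‖_∞ ≤ B₀/m` needs no truncation.
--
-- For general `D` the mean factorises over the coordinates into the integrals `twistedMoment`. Mean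
-- `0` and variance `1` make a typical factor agree with `exp(-x_l²/2)` up to `O(|x_l|³)`, and
-- flatness sums these errors to `O(μ)`, as in Lindeberg's argument (`norm_prod_sub_exp_le`,
-- `abs_integral_cos_bilinear_sub_le`).
--
-- A bounded weight times two subgaussian linear forms is subexponential, so each bilinear form of
-- `Y` is near its mean outside an event of probability `2 exp(-cm)`
-- (`exists_rate_weighted_bilinear`). A union bound over pairs from a net of `5 ^ n` points is
-- affordable when `m ≥ κ₀ n`, and controls the operator norm (`exists_half_net`,
-- `opNorm_le_of_half_net`). Spectral closeness of `Y` to `-2 (I - x xᵀ)` gives both required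
-- bounds, because the tangential part of `Y` depends only on `Y x`
-- (`certificate_bounds_of_spectralNorm₂_le`).

attribute [local instance] Matrix.frobeniusNormedAddCommGroup Matrix.frobeniusNormedSpace
attribute [local instance] frobeniusInnerProductSpace

/-! ### Exponential moments and a Bernstein inequality -/

/-- A subgaussian tail bound gives a bounded exponential moment of the square. -/
theorem integrable_exp_sq_of_tail {Ω : Type*} [MeasurableSpace Ω] {P : Measure Ω}
    [IsProbabilityMeasure P] {X : Ω → ℝ} (hX : Measurable X) {L : ℝ} (hL : 0 < L)
    (h : ∀ u : ℝ, 1 ≤ u → P.real {ω | L * u ≤ |X ω|} ≤ 2 * Real.exp (-u ^ 2 / 2)) :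
    Integrable (fun ω => Real.exp (X ω ^ 2 / (4 * L ^ 2))) P ∧
      ∫ ω, Real.exp (X ω ^ 2 / (4 * L ^ 2)) ∂P
        ≤ 2 * Real.exp 1 * (1 - Real.exp (-1))⁻¹ := by
  have hr0 : (0 : ℝ) ≤ Real.exp (-1) := (Real.exp_pos _).le
  have hr1 : Real.exp (-1) < 1 := by rw [Real.exp_lt_one_iff]; norm_num
  set S : ℕ → Set Ω := fun k => {ω | (k : ℝ) ≤ X ω ^ 2 / (4 * L ^ 2)} with hS
  have hSm : ∀ k, MeasurableSet (S k) := fun k =>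
    measurableSet_le measurable_const (by fun_prop)
  -- For `k ≥ 1` this is the tail at `u = 2√k`. Against the value `exp (k + 1)` on the layer it
  -- leaves a geometric series of ratio `exp (-1)`.
  have hSP : ∀ k, P (S k) ≤ ENNReal.ofReal (2 * Real.exp (-2 * k)) := by
    intro k
    rcases Nat.eq_zero_or_pos k with rfl | hk
    · calc P (S 0) ≤ 1 := prob_le_one
        _ ≤ _ := by simp
    · have hk1 : (1 : ℝ) ≤ k := by exact_mod_cast hk
      have hsub : S k ⊆ {ω | L * (2 * Real.sqrt k) ≤ |X ω|} := by
        intro ω hω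
        simp only [hS, Set.mem_ofPred_eq] at hω ⊢
        rw [le_div_iff₀ (by positivity)] at hω
        apply le_of_sq_le_sq _ (abs_nonneg _)
        rw [sq_abs, mul_pow, mul_pow, Real.sq_sqrt (by positivity)]
        linarith
      have h1 : (1 : ℝ) ≤ 2 * Real.sqrt k := by
        have := Real.one_le_sqrt.mpr hk1
        linarith
      have h2 := h _ h1
      refine (measure_mono hsub).trans ?_
      rw [← ENNReal.ofReal_toReal (measure_ne_top P _)]
      apply ENNReal.ofReal_le_ofReal
      refine h2.trans_eq ?_
      rw [mul_pow, Real.sq_sqrt (by positivity)]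
      congr 2
      ring
  have hpt : ∀ ω, ENNReal.ofReal (Real.exp (X ω ^ 2 / (4 * L ^ 2))) ≤
      ∑' k : ℕ, (S k).indicator (fun _ => ENNReal.ofReal (Real.exp (k + 1))) ω := by
    intro ω
    have h0 : 0 ≤ X ω ^ 2 / (4 * L ^ 2) := by positivity
    refine le_trans ?_ (ENNReal.le_tsum ⌊X ω ^ 2 / (4 * L ^ 2)⌋₊)
    rw [Set.indicator_of_mem (by exact Nat.floor_le h0)]
    exact ENNReal.ofReal_le_ofReal (Real.exp_le_exp.mpr (Nat.lt_floor_add_one _).le)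
  have hlin : ∫⁻ ω, ENNReal.ofReal (Real.exp (X ω ^ 2 / (4 * L ^ 2))) ∂P ≤
      ENNReal.ofReal (2 * Real.exp 1 * (1 - Real.exp (-1))⁻¹) := by
    calc _ ≤ ∫⁻ ω, ∑' k : ℕ,
          (S k).indicator (fun _ => ENNReal.ofReal (Real.exp (k + 1))) ω ∂P := lintegral_mono hpt
      _ = ∑' k : ℕ, ENNReal.ofReal (Real.exp (k + 1)) * P (S k) := by
          rw [lintegral_tsum fun k => (measurable_const.indicator (hSm k)).aemeasurable]
          exact tsum_congr fun k => lintegral_indicator_const (hSm k) _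
      _ ≤ ∑' k : ℕ, ENNReal.ofReal (2 * Real.exp 1 * Real.exp (-1) ^ k) := by
          refine ENNReal.tsum_le_tsum fun k => ?_
          refine (mul_le_mul_right (hSP k) _).trans_eq ?_
          rw [← ENNReal.ofReal_mul (Real.exp_pos _).le]
          congr 1
          rw [← Real.exp_nat_mul, mul_left_comm, mul_assoc, ← Real.exp_add, ← Real.exp_add]
          congr 2
          ring
      _ = _ := by
          rw [← ENNReal.ofReal_tsum_of_nonneg (fun k => by positivity)
            ((summable_geometric_of_lt_one hr0 hr1).mul_left _), tsum_mul_left,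
            tsum_geometric_of_lt_one hr0 hr1]
  have hm : AEStronglyMeasurable (fun ω => Real.exp (X ω ^ 2 / (4 * L ^ 2))) P := by
    apply Measurable.aestronglyMeasurable; fun_prop
  refine ⟨⟨hm, ?_⟩, ?_⟩
  · rw [hasFiniteIntegral_iff_ofReal (ae_of_all _ fun ω => (Real.exp_pos _).le)]
    exact hlin.trans_lt ENNReal.ofReal_lt_top
  · rw [integral_eq_lintegral_of_nonneg_ae (ae_of_all _ fun ω => (Real.exp_pos _).le) hm]
    apply ENNReal.toReal_le_of_le_ofReal _ hlin
    have : 0 < 1 - Real.exp (-1) := by linarith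
    positivity

/-- Second-order Taylor remainder. The linear term is kept because it integrates to zero for a
centred variable. -/
theorem exp_le_one_add_add_sq_mul_exp_abs (z : ℝ) :
    Real.exp z ≤ 1 + z + z ^ 2 * Real.exp |z| := by
  have h := Complex.norm_exp_sub_sum_le_norm_mul_exp (z : ℂ) 2
  have h2 : Complex.exp (z : ℂ) - ∑ m ∈ Finset.range 2, (z : ℂ) ^ m / (m.factorial : ℂ)
      = ((Real.exp z - (1 + z) : ℝ) : ℂ) := by
    simp [Finset.sum_range_succ]
  rw [h2, Complex.norm_real, Complex.norm_real, Real.norm_eq_abs, Real.norm_eq_abs, sq_abs] at h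
  linarith [le_abs_self (Real.exp z - (1 + z))]

/-- `x² ≤ (8 / θ²) exp (θ |x| / 2)`. -/
theorem sq_le_mul_exp_abs {θ : ℝ} (hθ : 0 < θ) (x : ℝ) :
    x ^ 2 ≤ 8 / θ ^ 2 * Real.exp (θ / 2 * |x|) := by
  have h := Real.quadratic_le_exp_of_nonneg (x := θ / 2 * |x|) (by positivity)
  have h1 : (θ / 2 * |x|) ^ 2 = θ ^ 2 / 4 * x ^ 2 := by rw [mul_pow, sq_abs]; ring
  have h2 : 0 ≤ θ / 2 * |x| := by positivity
  rw [div_mul_eq_mul_div, le_div_iff₀ (by positivity)]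
  nlinarith

theorem integrable_of_exp_abs {Ω : Type*} [MeasurableSpace Ω] {P : Measure Ω}
    {X : Ω → ℝ} (hX : AEStronglyMeasurable X P) {θ : ℝ} (hθ : 0 < θ)
    (hi : Integrable (fun ω => Real.exp (θ * |X ω|)) P) : Integrable X P := by
  refine (hi.const_mul θ⁻¹).mono' hX (ae_of_all _ fun ω => ?_)
  rw [Real.norm_eq_abs, ← div_eq_inv_mul, le_div_iff₀ hθ, mul_comm]
  linarith [Real.add_one_le_exp (θ * |X ω|)]

/-- Moment generating function bound of a centred variable with an exponential moment. -/
theorem mgf_le_of_exp_abs {Ω : Type*} [MeasurableSpace Ω] {P : Measure Ω}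
    [IsProbabilityMeasure P] {X : Ω → ℝ} (hX : AEStronglyMeasurable X P) {θ C : ℝ} (hθ : 0 < θ)
    (hi : Integrable (fun ω => Real.exp (θ * |X ω|)) P)
    (hC : ∫ ω, Real.exp (θ * |X ω|) ∂P ≤ C) (h0 : ∫ ω, X ω ∂P = 0) {s : ℝ} (hs : |s| ≤ θ / 2) :
    Integrable (fun ω => Real.exp (s * X ω)) P ∧
      ∫ ω, Real.exp (s * X ω) ∂P ≤ Real.exp (8 * C / θ ^ 2 * s ^ 2) := by
  have hXi := integrable_of_exp_abs hX hθ hi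
  have hsX : ∀ ω, |s * X ω| ≤ θ / 2 * |X ω| := fun ω => by
    rw [abs_mul]; gcongr
  have hint : Integrable (fun ω => Real.exp (s * X ω)) P := by
    refine hi.mono' (Real.continuous_exp.comp_aestronglyMeasurable (hX.const_mul s))
      (ae_of_all _ fun ω => ?_)
    rw [Real.norm_eq_abs, abs_of_pos (Real.exp_pos _), Real.exp_le_exp]
    have := hsX ω
    have h2 : 0 ≤ θ / 2 * |X ω| := by positivity
    linarith [le_abs_self (s * X ω)]
  refine ⟨hint, ?_⟩
  -- Half of the exponent `θ |X|` absorbs the factor `X²`, the other half absorbs `exp |s X|`.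
  have hpt : ∀ ω, Real.exp (s * X ω) ≤
      1 + s * X ω + 8 / θ ^ 2 * s ^ 2 * Real.exp (θ * |X ω|) := by
    intro ω
    refine (exp_le_one_add_add_sq_mul_exp_abs _).trans ?_
    refine add_le_add_right ?_ _
    calc (s * X ω) ^ 2 * Real.exp |s * X ω|
        ≤ s ^ 2 * (8 / θ ^ 2 * Real.exp (θ / 2 * |X ω|)) * Real.exp (θ / 2 * |X ω|) := by
          rw [mul_pow]
          gcongr
          · exact sq_le_mul_exp_abs hθ _
          · exact hsX ω
      _ = 8 / θ ^ 2 * s ^ 2 * (Real.exp (θ / 2 * |X ω|) * Real.exp (θ / 2 * |X ω|)) := by ring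
      _ = _ := by
          rw [← Real.exp_add]
          congr 2
          ring_nf
  calc ∫ ω, Real.exp (s * X ω) ∂P
      ≤ ∫ ω, (1 + s * X ω + 8 / θ ^ 2 * s ^ 2 * Real.exp (θ * |X ω|)) ∂P :=
        integral_mono hint (((integrable_const _).add (hXi.const_mul _)).add (hi.const_mul _)) hpt
    _ = 1 + 8 / θ ^ 2 * s ^ 2 * ∫ ω, Real.exp (θ * |X ω|) ∂P := by
        have hi1 : Integrable (fun ω => 1 + s * X ω) P :=
          (integrable_const _).add (hXi.const_mul _)
        rw [integral_add hi1 (hi.const_mul _),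
          integral_add (integrable_const _) (hXi.const_mul _), integral_const_mul,
          integral_const_mul, h0]
        simp
    _ ≤ 1 + 8 / θ ^ 2 * s ^ 2 * C := by gcongr
    _ ≤ _ := by
        refine le_trans (le_of_eq ?_) (Real.add_one_le_exp _)
        ring

/-- The rate in the Bernstein type inequality below. -/
noncomputable def bernsteinRate (θ C t : ℝ) : ℝ := min (θ / 2) (t * θ ^ 2 / (16 * C)) * t / 2

theorem bernsteinRate_pos {θ C t : ℝ} (hθ : 0 < θ) (hC : 0 < C) (ht : 0 < t) :
    0 < bernsteinRate θ C t := by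
  unfold bernsteinRate
  have : 0 < min (θ / 2) (t * θ ^ 2 / (16 * C)) := lt_min (by positivity) (by positivity)
  positivity

/-- One-sided Bernstein type inequality for independent copies of a centred variable. -/
theorem measure_sum_ge_le_of_exp_abs {Ω : Type*} [MeasurableSpace Ω] {P : Measure Ω}
    [IsProbabilityMeasure P] {X : Ω → ℝ} (hX : Measurable X) {θ C t : ℝ} (hθ : 0 < θ)
    (hC0 : 0 < C) (ht : 0 < t)
    (hi : Integrable (fun ω => Real.exp (θ * |X ω|)) P)
    (hC : ∫ ω, Real.exp (θ * |X ω|) ∂P ≤ C) (h0 : ∫ ω, X ω ∂P = 0) (m : ℕ) :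
    (Measure.pi fun _ : Fin m => P).real {a | m * t ≤ ∑ i, X (a i)} ≤
      Real.exp (-bernsteinRate θ C t * m) := by
  -- The first bound keeps `s` in the range of the moment generating function estimate; the second
  -- makes the quadratic cost at most half of the gain `s t`.
  set s := min (θ / 2) (t * θ ^ 2 / (16 * C)) with hs
  have hs0 : 0 < s := lt_min (by positivity) (by positivity)
  have hs1 : |s| ≤ θ / 2 := by rw [abs_of_pos hs0]; exact min_le_left _ _
  have hs2 : s ≤ t * θ ^ 2 / (16 * C) := min_le_right _ _
  obtain ⟨hint, hle⟩ := mgf_le_of_exp_abs hX.aestronglyMeasurable hθ hi hC h0 hs1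
  have hprod : ∀ a : Fin m → Ω,
      Real.exp (s * ∑ i, X (a i)) = ∏ i, Real.exp (s * X (a i)) := fun a => by
    rw [Finset.mul_sum, Real.exp_sum]
  have hint' : Integrable (fun a : Fin m → Ω => Real.exp (s * ∑ i, X (a i)))
      (Measure.pi fun _ => P) := by
    simp_rw [hprod]
    exact Integrable.fintype_prod (f := fun _ ω => Real.exp (s * X ω)) fun _ => hint
  refine (ProbabilityTheory.measure_ge_le_exp_mul_mgf (m * t) hs0.le hint').trans ?_
  have hmgf : ProbabilityTheory.mgf (fun a : Fin m → Ω => ∑ i, X (a i)) (Measure.pi fun _ => P) s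
      ≤ Real.exp (8 * C / θ ^ 2 * s ^ 2) ^ m := by
    unfold ProbabilityTheory.mgf
    simp_rw [hprod]
    rw [integral_fintype_prod_eq_pow (ι := Fin m) (μ := P) (fun ω => Real.exp (s * X ω)),
      Fintype.card_fin]
    gcongr
  refine (mul_le_mul_of_nonneg_left hmgf (Real.exp_pos _).le).trans ?_
  rw [← Real.exp_nat_mul, ← Real.exp_add, Real.exp_le_exp]
  have h3 : 8 * C / θ ^ 2 * s ≤ t / 2 := by
    rw [le_div_iff₀ (by positivity)] at hs2
    rw [div_mul_eq_mul_div, div_le_iff₀ (by positivity)]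
    linarith
  have h4 : 8 * C / θ ^ 2 * s ^ 2 ≤ s * t / 2 := by nlinarith
  have h5 : (m : ℝ) * (8 * C / θ ^ 2 * s ^ 2) ≤ m * (s * t / 2) := by gcongr
  unfold bernsteinRate
  rw [← hs]
  linarith

/-- Two-sided Bernstein type inequality for independent copies of a centred variable. -/
theorem measure_abs_sum_ge_le_of_exp_abs {Ω : Type*} [MeasurableSpace Ω] {P : Measure Ω}
    [IsProbabilityMeasure P] {X : Ω → ℝ} (hX : Measurable X) {θ C t : ℝ} (hθ : 0 < θ)
    (hC0 : 0 < C) (ht : 0 < t)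
    (hi : Integrable (fun ω => Real.exp (θ * |X ω|)) P)
    (hC : ∫ ω, Real.exp (θ * |X ω|) ∂P ≤ C) (h0 : ∫ ω, X ω ∂P = 0) (m : ℕ) :
    (Measure.pi fun _ : Fin m => P).real {a | m * t ≤ |∑ i, X (a i)|} ≤
      2 * Real.exp (-bernsteinRate θ C t * m) := by
  have h1 := measure_sum_ge_le_of_exp_abs hX hθ hC0 ht hi hC h0 m
  have h2 := measure_sum_ge_le_of_exp_abs (X := fun ω => -X ω) hX.neg hθ hC0 ht
    (by simpa using hi) (by simpa using hC) (by rw [integral_neg, h0, neg_zero]) m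
  have hsub : {a : Fin m → Ω | m * t ≤ |∑ i, X (a i)|} ⊆
      {a | m * t ≤ ∑ i, X (a i)} ∪ {a | m * t ≤ ∑ i, -X (a i)} := by
    intro a ha
    simp only [Set.mem_union, Set.mem_ofPred_eq, Finset.sum_neg_distrib] at ha ⊢
    exact le_abs.mp ha
  refine (measureReal_mono hsub).trans ((measureReal_union_le _ _).trans ?_)
  linarith

/-! ### Subgaussian linear forms and concentration of weighted products -/

/-- A centred law with subgaussian tails has a subgaussian moment generating function. -/
theorem IsSubgaussianWith.exists_hasSubgaussianMGF {D : Measure ℝ} [IsProbabilityMeasure D] {L : ℝ}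
    (h : IsSubgaussianWith D L) (hmean : ∫ t, t ∂D = 0) :
    ∃ K : NNReal, 0 < K ∧ ProbabilityTheory.HasSubgaussianMGF (fun t : ℝ => t) K D := by
  obtain ⟨hL, hu⟩ := h
  obtain ⟨hi, hle⟩ := integrable_exp_sq_of_tail (P := D) measurable_id hL hu
  simp only [id_eq] at hi hle
  set C := 2 * Real.exp 1 * (1 - Real.exp (-1))⁻¹ with hC
  have hCpos : 0 < C := by
    have : Real.exp (-1) < 1 := by rw [Real.exp_lt_one_iff]; norm_num
    have : 0 < 1 - Real.exp (-1) := by linarith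
    positivity
  have hpt : ∀ s x : ℝ, s * |x| ≤ x ^ 2 / (4 * L ^ 2) + L ^ 2 * s ^ 2 := by
    intro s x
    have : x ^ 2 / (4 * L ^ 2) + L ^ 2 * s ^ 2 - s * |x| = (|x| / (2 * L) - L * s) ^ 2 := by
      rw [sub_sq, div_pow, sq_abs]
      field_simp
      ring
    nlinarith [sq_nonneg (|x| / (2 * L) - L * s)]
  have habs : ∀ s : ℝ, Integrable (fun x : ℝ => Real.exp (s * |x|)) D ∧
      ∫ x, Real.exp (s * |x|) ∂D ≤ C * Real.exp (L ^ 2 * s ^ 2) := by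
    intro s
    have hb : ∀ x : ℝ, Real.exp (s * |x|) ≤
        Real.exp (x ^ 2 / (4 * L ^ 2)) * Real.exp (L ^ 2 * s ^ 2) := fun x => by
      rw [← Real.exp_add]
      exact Real.exp_le_exp.mpr (hpt s x)
    have hint : Integrable (fun x : ℝ => Real.exp (s * |x|)) D := by
      refine (hi.mul_const (Real.exp (L ^ 2 * s ^ 2))).mono'
        (Measurable.aestronglyMeasurable (by fun_prop)) (ae_of_all _ fun x => ?_)
      rw [Real.norm_eq_abs, abs_of_pos (Real.exp_pos _)]
      exact hb x
    refine ⟨hint, (integral_mono hint (hi.mul_const _) hb).trans ?_⟩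
    rw [integral_mul_const]
    gcongr
  have hmul : ∀ s : ℝ, Integrable (fun x : ℝ => Real.exp (s * x)) D := fun s => by
    refine (habs |s|).1.mono' (Measurable.aestronglyMeasurable (by fun_prop))
      (ae_of_all _ fun x => ?_)
    rw [Real.norm_eq_abs, abs_of_pos (Real.exp_pos _), Real.exp_le_exp, ← abs_mul]
    exact le_abs_self _
  -- One constant for two regimes: `8 C exp(L²)` serves `|s| ≤ 1/2`, where centring matters, and `4
  -- C + L²` serves `|s| > 1/2`.
  refine ⟨Real.toNNReal (2 * (4 * C + L ^ 2 + 8 * (C * Real.exp (L ^ 2 * 1 ^ 2)))),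
    Real.toNNReal_pos.mpr (by positivity), hmul, ?_⟩
  intro s
  unfold ProbabilityTheory.mgf
  rw [Real.coe_toNNReal _ (by positivity)]
  rcases le_or_gt |s| (1 / 2) with hs | hs
  · have h1 := (mgf_le_of_exp_abs (P := D) (X := fun x => x) (θ := 1)
      measurable_id.aestronglyMeasurable one_pos (habs 1).1 (habs 1).2 hmean hs).2
    refine h1.trans (Real.exp_le_exp.mpr ?_)
    have : 0 ≤ (4 * C + L ^ 2) * s ^ 2 := by positivity
    linarith
  · have h1 : ∫ x, Real.exp (s * x) ∂D ≤ ∫ x, Real.exp (|s| * |x|) ∂D := by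
      refine integral_mono (hmul s) (habs |s|).1 fun x => ?_
      rw [← abs_mul]
      exact Real.exp_le_exp.mpr (le_abs_self _)
    refine h1.trans ((habs |s|).2.trans ?_)
    -- Away from `s = 0` the prefactor `C` can be moved into the exponent, since `4 s² ≥ 1`.
    have h2 : C ≤ Real.exp (4 * C * s ^ 2) := by
      have h3 : 1 / 4 ≤ s ^ 2 := by
        rw [← sq_abs]; nlinarith
      have h4 : C ≤ 4 * C * s ^ 2 := by nlinarith
      linarith [Real.add_one_le_exp (4 * C * s ^ 2)]
    calc C * Real.exp (L ^ 2 * |s| ^ 2)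
        ≤ Real.exp (4 * C * s ^ 2) * Real.exp (L ^ 2 * |s| ^ 2) := by gcongr
      _ ≤ _ := by
        rw [← Real.exp_add, Real.exp_le_exp, sq_abs]
        have : 0 ≤ C * Real.exp (L ^ 2 * 1 ^ 2) := by positivity
        generalize C * Real.exp (L ^ 2 * 1 ^ 2) = E at this
        nlinarith [mul_nonneg this (sq_nonneg s)]

/-- Linear forms with coefficients in the unit ball are uniformly subgaussian. -/
theorem hasSubgaussianMGF_dotProduct {D : Measure ℝ} [IsProbabilityMeasure D] {K : NNReal}
    (hD : ProbabilityTheory.HasSubgaussianMGF (fun t : ℝ => t) K D) {n : ℕ} (u : Fin n → ℝ)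
    (hu : ∑ j, u j ^ 2 ≤ 1) :
    ProbabilityTheory.HasSubgaussianMGF (fun a : Fin n → ℝ => u ⬝ᵥ a) K
      (Measure.pi fun _ => D) := by
  have hprod : ∀ (s : ℝ) (a : Fin n → ℝ),
      Real.exp (s * (u ⬝ᵥ a)) = ∏ j, Real.exp (s * u j * a j) := fun s a => by
    simp_rw [dotProduct, Finset.mul_sum, Real.exp_sum, mul_assoc]
  constructor
  · intro s
    simp_rw [hprod]
    exact Integrable.fintype_prod (f := fun j t => Real.exp (s * u j * t))
      fun j => hD.integrable_exp_mul _
  · intro s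
    unfold ProbabilityTheory.mgf
    simp_rw [hprod]
    rw [integral_fintype_prod_eq_prod (fun j t => Real.exp (s * u j * t))]
    calc ∏ j, ∫ t, Real.exp (s * u j * t) ∂D
        ≤ ∏ j, Real.exp (K * (s * u j) ^ 2 / 2) :=
          Finset.prod_le_prod (fun j _ => integral_nonneg fun _ => (Real.exp_pos _).le)
            fun j _ => hD.mgf_le _
      _ = Real.exp (K * s ^ 2 / 2 * ∑ j, u j ^ 2) := by
          rw [← Real.exp_sum, Finset.mul_sum]
          congr 1
          exact Finset.sum_congr rfl fun j _ => by ring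
      _ ≤ _ := by
          rw [Real.exp_le_exp]
          have : 0 ≤ (K : ℝ) * s ^ 2 / 2 := by positivity
          nlinarith

/-- Squares of linear forms have uniformly bounded exponential moments. -/
theorem integrable_exp_dotProduct_sq {D : Measure ℝ} [IsProbabilityMeasure D] {K : NNReal}
    (hK : 0 < K) (hD : ProbabilityTheory.HasSubgaussianMGF (fun t : ℝ => t) K D) {n : ℕ}
    (u : Fin n → ℝ) (hu : ∑ j, u j ^ 2 ≤ 1) :
    Integrable (fun a : Fin n → ℝ => Real.exp ((u ⬝ᵥ a) ^ 2 / (4 * K))) (Measure.pi fun _ => D) ∧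
      ∫ a : Fin n → ℝ, Real.exp ((u ⬝ᵥ a) ^ 2 / (4 * K)) ∂(Measure.pi fun _ => D)
        ≤ 2 * Real.exp 1 * (1 - Real.exp (-1))⁻¹ := by
  have hs := hasSubgaussianMGF_dotProduct hD u hu
  have hK' : (0 : ℝ) < K := hK
  have hm : Measurable fun a : Fin n → ℝ => u ⬝ᵥ a := by unfold dotProduct; fun_prop
  have key := integrable_exp_sq_of_tail (P := Measure.pi fun _ : Fin n => D) hm
    (L := Real.sqrt K) (Real.sqrt_pos.mpr hK') ?_
  · simpa only [Real.sq_sqrt hK'.le] using key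
  intro x hx
  have hε : 0 ≤ Real.sqrt K * x := by positivity
  have h1 := hs.measure_ge_le hε
  have h2 := hs.neg.measure_ge_le hε
  have he : -(Real.sqrt K * x) ^ 2 / (2 * (K : ℝ)) = -x ^ 2 / 2 := by
    rw [mul_pow, Real.sq_sqrt hK'.le]
    field_simp
  rw [he] at h1 h2
  have hsub : {a : Fin n → ℝ | Real.sqrt K * x ≤ |u ⬝ᵥ a|} ⊆
      {a | Real.sqrt K * x ≤ u ⬝ᵥ a} ∪
        {a | Real.sqrt K * x ≤ (-fun a : Fin n → ℝ => u ⬝ᵥ a) a} := by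
    intro a ha
    exact le_abs.mp (show _ ≤ |u ⬝ᵥ a| from ha)
  refine (measureReal_mono hsub).trans ((measureReal_union_le _ _).trans ?_)
  linarith

/-- Uniform concentration of bounded weights times products of two linear forms. -/
theorem exists_rate_weighted_bilinear {D : Measure ℝ} [IsProbabilityMeasure D] {K : NNReal}
    (hK : 0 < K) (hD : ProbabilityTheory.HasSubgaussianMGF (fun t : ℝ => t) K D)
    {B t : ℝ} (hB : 0 < B) (ht : 0 < t) :
    ∃ c : ℝ, 0 < c ∧ ∀ (n m : ℕ) (w : (Fin n → ℝ) → ℝ), Measurable w → (∀ a, |w a| ≤ B) →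
      ∀ u v : Fin n → ℝ, ∑ j, u j ^ 2 ≤ 1 → ∑ j, v j ^ 2 ≤ 1 →
        (measurementLaw D n m).real {a | m * t ≤
          |∑ i, (w (a i) * (u ⬝ᵥ a i) * (v ⬝ᵥ a i)
            - ∫ b, w b * (u ⬝ᵥ b) * (v ⬝ᵥ b) ∂(Measure.pi fun _ => D))|} ≤
          2 * Real.exp (-c * m) := by
  set C := 2 * Real.exp 1 * (1 - Real.exp (-1))⁻¹ with hC
  have hCpos : 0 < C := by
    have : Real.exp (-1) < 1 := by rw [Real.exp_lt_one_iff]; norm_num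
    have : 0 < 1 - Real.exp (-1) := by linarith
    positivity
  have hK' : (0 : ℝ) < K := hK
  -- With this `θ`, the inequality `2|pq| ≤ p² + q²` bounds `θ |W|` by the average of the two
  -- exponents `(u ⬝ᵥ a)²/(4K)` and `(v ⬝ᵥ a)²/(4K)`, uniformly in `n`, `w`, `u`, `v`.
  set θ := 1 / (4 * K * B) with hθ
  have hθ0 : 0 < θ := by positivity
  refine ⟨bernsteinRate θ (C * Real.exp C) t, bernsteinRate_pos hθ0 (by positivity) ht, ?_⟩
  intro n m w hw hwB u v hu hv
  set P : Measure (Fin n → ℝ) := Measure.pi fun _ => D with hP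
  set W : (Fin n → ℝ) → ℝ := fun a => w a * (u ⬝ᵥ a) * (v ⬝ᵥ a) with hW
  have hWm : Measurable W := by
    have h1 : ∀ u : Fin n → ℝ, Measurable fun a : Fin n → ℝ => u ⬝ᵥ a := fun u => by
      unfold dotProduct; fun_prop
    exact (hw.mul (h1 u)).mul (h1 v)
  obtain ⟨hiu, hu'⟩ := integrable_exp_dotProduct_sq hK hD u hu
  obtain ⟨hiv, hv'⟩ := integrable_exp_dotProduct_sq hK hD v hv
  have hpt : ∀ a, Real.exp (θ * |W a|) ≤ (Real.exp ((u ⬝ᵥ a) ^ 2 / (4 * K)) +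
      Real.exp ((v ⬝ᵥ a) ^ 2 / (4 * K))) / 2 := by
    intro a
    have h1 : |W a| ≤ B * (((u ⬝ᵥ a) ^ 2 + (v ⬝ᵥ a) ^ 2) / 2) := by
      rw [hW]
      simp only
      rw [mul_assoc, abs_mul, abs_mul]
      refine mul_le_mul (hwB a) ?_ (by positivity) hB.le
      nlinarith [sq_nonneg (|u ⬝ᵥ a| - |v ⬝ᵥ a|), sq_abs (u ⬝ᵥ a), sq_abs (v ⬝ᵥ a)]
    have h2 : θ * |W a| ≤ (u ⬝ᵥ a) ^ 2 / (4 * K) / 2 + (v ⬝ᵥ a) ^ 2 / (4 * K) / 2 := by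
      calc θ * |W a| ≤ θ * (B * (((u ⬝ᵥ a) ^ 2 + (v ⬝ᵥ a) ^ 2) / 2)) := by gcongr
        _ = _ := by rw [hθ]; field_simp
    refine (Real.exp_le_exp.mpr h2).trans ?_
    have e : ∀ x : ℝ, Real.exp x = Real.exp (x / 2) ^ 2 := fun x => by
      rw [← Real.exp_nat_mul]; congr 1; push_cast; ring
    rw [Real.exp_add, e ((u ⬝ᵥ a) ^ 2 / (4 * K)), e ((v ⬝ᵥ a) ^ 2 / (4 * K))]
    nlinarith [sq_nonneg (Real.exp ((u ⬝ᵥ a) ^ 2 / (4 * K) / 2) -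
      Real.exp ((v ⬝ᵥ a) ^ 2 / (4 * K) / 2))]
  have hiW : Integrable (fun a => Real.exp (θ * |W a|)) P := by
    refine ((hiu.add hiv).div_const 2).mono' (Measurable.aestronglyMeasurable (by fun_prop))
      (ae_of_all _ fun a => ?_)
    rw [Real.norm_eq_abs, abs_of_pos (Real.exp_pos _)]
    exact hpt a
  have hCW : ∫ a, Real.exp (θ * |W a|) ∂P ≤ C := by
    refine (integral_mono hiW ((hiu.add hiv).div_const 2) hpt).trans ?_
    rw [integral_div]
    have := integral_add hiu hiv
    simp only [Pi.add_apply]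
    rw [this]
    linarith
  have hWi : Integrable W P := integrable_of_exp_abs hWm.aestronglyMeasurable hθ0 hiW
  set e := ∫ b, W b ∂P with he
  -- Hence subtracting the mean costs only a factor `exp C` in the exponential moment.
  have hE : θ * |e| ≤ C := by
    have h1 : |e| ≤ ∫ b, |W b| ∂P := abs_integral_le_integral_abs
    have h2 : ∫ b, θ * |W b| ∂P ≤ ∫ b, Real.exp (θ * |W b|) ∂P :=
      integral_mono (hWi.abs.const_mul θ) hiW fun b => by
        linarith [Real.add_one_le_exp (θ * |W b|)]
    rw [integral_const_mul] at h2
    calc θ * |e| ≤ θ * ∫ b, |W b| ∂P := by gcongr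
      _ ≤ C := h2.trans hCW
  have hpt2 : ∀ a, Real.exp (θ * |W a - e|) ≤ Real.exp (θ * |W a|) * Real.exp C := by
    intro a
    rw [← Real.exp_add, Real.exp_le_exp]
    have : θ * |W a - e| ≤ θ * (|W a| + |e|) := by gcongr; exact abs_sub _ _
    linarith
  have hiZ : Integrable (fun a => Real.exp (θ * |W a - e|)) P := by
    refine (hiW.mul_const (Real.exp C)).mono' (Measurable.aestronglyMeasurable (by fun_prop))
      (ae_of_all _ fun a => ?_)
    rw [Real.norm_eq_abs, abs_of_pos (Real.exp_pos _)]
    exact hpt2 a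
  have hCZ : ∫ a, Real.exp (θ * |W a - e|) ∂P ≤ C * Real.exp C := by
    refine (integral_mono hiZ (hiW.mul_const _) hpt2).trans ?_
    rw [integral_mul_const]
    gcongr
  exact measure_abs_sum_ge_le_of_exp_abs (P := P) (X := fun a => W a - e) (hWm.sub_const e) hθ0
    (by positivity) ht hiZ hCZ (by rw [integral_sub hWi (integrable_const _)]; simp [he]) m

/-! ### Taylor expansion of the twisted moments -/

/-- The moment `∫ yᵏ exp (i t y) dD(y)`. -/
noncomputable def twistedMoment (D : Measure ℝ) (k : ℕ) (t : ℝ) : ℂ :=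
  ∫ y : ℝ, (y : ℂ) ^ k * Complex.exp (t * y * Complex.I) ∂D

/-- Dominates the Taylor remainders below: `|y|^k ≤ k! exp |y|`, and `exp (2|y|)` is at most the sum
of the two one-sided exponentials. -/
theorem integrable_abs_pow_mul_exp_abs {D : Measure ℝ} [IsProbabilityMeasure D] {K : NNReal}
    (hD : ProbabilityTheory.HasSubgaussianMGF (fun t : ℝ => t) K D) (k : ℕ) :
    Integrable (fun y : ℝ => |y| ^ k * Real.exp |y|) D := by
  refine (((hD.integrable_exp_mul 2).add (hD.integrable_exp_mul (-2))).const_mul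
    (k.factorial : ℝ)).mono' (Measurable.aestronglyMeasurable (by fun_prop))
    (ae_of_all _ fun y => ?_)
  rw [Real.norm_eq_abs, abs_of_nonneg (by positivity), Pi.add_apply]
  have h1 := Real.pow_div_factorial_le_exp |y| (abs_nonneg y) k
  rw [div_le_iff₀ (by positivity)] at h1
  have h2 : Real.exp |y| * Real.exp |y| ≤ Real.exp (2 * y) + Real.exp (-2 * y) := by
    rw [← Real.exp_add]
    rcases abs_cases y with ⟨h, _⟩ | ⟨h, _⟩ <;> rw [h]
    · rw [← two_mul]; linarith [Real.exp_pos (-2 * y)]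
    · rw [show -y + -y = -2 * y by ring]; linarith [Real.exp_pos (2 * y)]
  calc |y| ^ k * Real.exp |y| ≤ Real.exp |y| * k.factorial * Real.exp |y| := by gcongr
    _ = k.factorial * (Real.exp |y| * Real.exp |y|) := by ring
    _ ≤ _ := by gcongr

theorem integrable_abs_pow {D : Measure ℝ} [IsProbabilityMeasure D] {K : NNReal}
    (hD : ProbabilityTheory.HasSubgaussianMGF (fun t : ℝ => t) K D) (k : ℕ) :
    Integrable (fun y : ℝ => |y| ^ k) D := by
  refine (integrable_abs_pow_mul_exp_abs hD k).mono'
    (Measurable.aestronglyMeasurable (by fun_prop)) (ae_of_all _ fun y => ?_)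
  rw [Real.norm_eq_abs, abs_of_nonneg (by positivity)]
  exact le_mul_of_one_le_right (by positivity) (Real.one_le_exp (abs_nonneg y))

theorem norm_exp_ofReal_mul_ofReal_mul_I (t y : ℝ) :
    ‖Complex.exp (t * y * Complex.I)‖ = 1 := by
  rw [← Complex.ofReal_mul, Complex.norm_exp_ofReal_mul_I]

theorem integrable_twisted {D : Measure ℝ} [IsProbabilityMeasure D] {K : NNReal}
    (hD : ProbabilityTheory.HasSubgaussianMGF (fun t : ℝ => t) K D) (k : ℕ) (t : ℝ) :
    Integrable (fun y : ℝ => (y : ℂ) ^ k * Complex.exp (t * y * Complex.I)) D := by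
  refine (integrable_abs_pow hD k).mono' (Measurable.aestronglyMeasurable (by fun_prop))
    (ae_of_all _ fun y => ?_)
  rw [norm_mul, norm_exp_ofReal_mul_ofReal_mul_I, mul_one, norm_pow, Complex.norm_real,
    Real.norm_eq_abs]

theorem integrable_ofReal_pow {D : Measure ℝ} [IsProbabilityMeasure D] {K : NNReal}
    (hD : ProbabilityTheory.HasSubgaussianMGF (fun t : ℝ => t) K D) (k : ℕ) :
    Integrable (fun y : ℝ => (y : ℂ) ^ k) D := by
  simpa using integrable_twisted hD k 0

theorem norm_twistedMoment_le {D : Measure ℝ} [IsProbabilityMeasure D] (k : ℕ) (t : ℝ) :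
    ‖twistedMoment D k t‖ ≤ ∫ y, |y| ^ k ∂D := by
  refine (norm_integral_le_integral_norm _).trans_eq (integral_congr_ae (ae_of_all _ fun y => ?_))
  simp only
  rw [norm_mul, norm_exp_ofReal_mul_ofReal_mul_I, mul_one, norm_pow, Complex.norm_real,
    Real.norm_eq_abs]

/-- Taylor expansion of the twisted moments at `0`, with a remainder of total order three. -/
theorem norm_twistedMoment_sub_sum_le {D : Measure ℝ} [IsProbabilityMeasure D] {K : NNReal}
    (hD : ProbabilityTheory.HasSubgaussianMGF (fun t : ℝ => t) K D) {k r : ℕ} (hk : k + r = 3)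
    {t : ℝ} (ht : |t| ≤ 1) :
    ‖twistedMoment D k t - ∑ i ∈ Finset.range r,
        (t * Complex.I) ^ i / (i.factorial : ℂ) * ∫ y : ℝ, (y : ℂ) ^ (k + i) ∂D‖
      ≤ (∫ y, |y| ^ 3 * Real.exp |y| ∂D) * |t| ^ r := by
  have hsum : ∑ i ∈ Finset.range r,
        (t * Complex.I) ^ i / (i.factorial : ℂ) * ∫ y : ℝ, (y : ℂ) ^ (k + i) ∂D
      = ∫ y : ℝ, ∑ i ∈ Finset.range r,
        (t * Complex.I) ^ i / (i.factorial : ℂ) * (y : ℂ) ^ (k + i) ∂D := by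
    rw [integral_finsetSum _ fun i _ => (integrable_ofReal_pow hD (k + i)).const_mul _]
    exact Finset.sum_congr rfl fun i _ => (integral_const_mul _ _).symm
  rw [hsum, twistedMoment, ← integral_sub (integrable_twisted hD k t)
    (integrable_finsetSum _ fun i _ => (integrable_ofReal_pow hD (k + i)).const_mul _),
    ← integral_mul_const]
  refine norm_integral_le_of_norm_le ((integrable_abs_pow_mul_exp_abs hD 3).mul_const _)
    (ae_of_all _ fun y => ?_)
  have h1 := Complex.norm_exp_sub_sum_le_norm_mul_exp ((t : ℂ) * y * Complex.I) r
  have hn : ‖(t : ℂ) * y * Complex.I‖ = |t| * |y| := by simp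
  have h2 : (y : ℂ) ^ k * Complex.exp (t * y * Complex.I) - ∑ i ∈ Finset.range r,
        (t * Complex.I) ^ i / (i.factorial : ℂ) * (y : ℂ) ^ (k + i)
      = (y : ℂ) ^ k * (Complex.exp (t * y * Complex.I) - ∑ i ∈ Finset.range r,
        ((t : ℂ) * y * Complex.I) ^ i / (i.factorial : ℂ)) := by
    rw [mul_sub, Finset.mul_sum]
    congr 1
    refine Finset.sum_congr rfl fun i _ => ?_
    ring
  rw [h2, norm_mul, norm_pow, Complex.norm_real, Real.norm_eq_abs]
  rw [hn] at h1
  calc |y| ^ k * ‖_‖ ≤ |y| ^ k * ((|t| * |y|) ^ r * Real.exp (|t| * |y|)) := by gcongr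
    _ ≤ |y| ^ k * ((|t| * |y|) ^ r * Real.exp |y|) := by
        gcongr
        exact mul_le_of_le_one_left (abs_nonneg y) ht
    _ = _ := by rw [← hk]; ring

theorem abs_exp_neg_half_sq_sub_le {t : ℝ} (ht : |t| ≤ 1) :
    |Real.exp (-t ^ 2 / 2) - (1 - t ^ 2 / 2)| ≤ |t| ^ 3 := by
  have h2 : |t| ^ 2 = t ^ 2 := sq_abs t
  have h0 := abs_nonneg t
  have h3 : |t| ^ 2 ≤ 1 := pow_le_one₀ h0 ht
  have h1 := Real.norm_exp_sub_one_sub_id_le (x := -t ^ 2 / 2) (by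
    rw [Real.norm_eq_abs, abs_le]; constructor <;> nlinarith)
  rw [Real.norm_eq_abs, Real.norm_eq_abs, sq_abs] at h1
  rw [show Real.exp (-t ^ 2 / 2) - (1 - t ^ 2 / 2) = Real.exp (-t ^ 2 / 2) - 1 - -t ^ 2 / 2 by ring]
  refine h1.trans ?_
  have h4 : |t| ^ 4 ≤ |t| ^ 3 := pow_le_pow_of_le_one h0 ht (by norm_num)
  have h5 : (-t ^ 2 / 2) ^ 2 = |t| ^ 4 / 4 := by
    rw [show |t| ^ 4 = (|t| ^ 2) ^ 2 by ring, h2]; ring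
  have : 0 ≤ |t| ^ 4 := by positivity
  linarith

theorem abs_exp_neg_half_sq_sub_one_le {t : ℝ} (ht : |t| ≤ 1) :
    |Real.exp (-t ^ 2 / 2) - 1| ≤ |t| := by
  have h1 : Real.exp (-t ^ 2 / 2) ≤ 1 := by
    rw [Real.exp_le_one_iff]; nlinarith [sq_nonneg t]
  have h2 := Real.add_one_le_exp (-t ^ 2 / 2)
  rw [abs_of_nonpos (by linarith)]
  nlinarith [sq_abs t, abs_nonneg t]

section moments

variable {D : Measure ℝ} [IsProbabilityMeasure D] {K : NNReal}

/-- The moments of order 0, 1 and 2 are those of the standard Gaussian, so the expansions agree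
through second order. The cubic error is what flatness can sum over all coordinates. -/
theorem norm_twistedMoment_zero_sub_le
    (hD : ProbabilityTheory.HasSubgaussianMGF (fun t : ℝ => t) K D)
    (hmean : ∫ t, t ∂D = 0) (hvar : ∫ t, t ^ 2 ∂D = 1) {t : ℝ} (ht : |t| ≤ 1) :
    ‖twistedMoment D 0 t - Real.exp (-t ^ 2 / 2)‖
      ≤ ((∫ y, |y| ^ 3 * Real.exp |y| ∂D) + 1) * |t| ^ 3 := by
  have h := norm_twistedMoment_sub_sum_le hD (k := 0) (r := 3) rfl ht
  have h1 : ∫ y : ℝ, (y : ℂ) ∂D = 0 := by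
    simpa [hmean] using integral_complex_ofReal (μ := D) (f := fun y : ℝ => y)
  have h2 : ∫ y : ℝ, (y : ℂ) ^ 2 ∂D = 1 := by
    simp_rw [← Complex.ofReal_pow]; simp [integral_complex_ofReal, hvar, -Complex.ofReal_pow]
  have h3 : ∑ i ∈ Finset.range 3,
      (t * Complex.I) ^ i / (i.factorial : ℂ) * ∫ y : ℝ, (y : ℂ) ^ (0 + i) ∂D
      = ((1 - t ^ 2 / 2 : ℝ) : ℂ) := by
    simp [Finset.sum_range_succ, h1, h2, mul_pow, Nat.factorial]
    ring
  rw [h3] at h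
  have h4 := abs_exp_neg_half_sq_sub_le ht
  rw [← Real.norm_eq_abs, ← Complex.norm_real, Complex.ofReal_sub, norm_sub_rev] at h4
  have := norm_sub_le_norm_sub_add_norm_sub (twistedMoment D 0 t) ((1 - t ^ 2 / 2 : ℝ) : ℂ)
    (Real.exp (-t ^ 2 / 2) : ℂ)
  linarith

/-- A first-order error is enough here: this factor occurs at a single coordinate, on the diagonal.
-/
theorem norm_twistedMoment_two_sub_le
    (hD : ProbabilityTheory.HasSubgaussianMGF (fun t : ℝ => t) K D)
    (hvar : ∫ t, t ^ 2 ∂D = 1) {t : ℝ} (ht : |t| ≤ 1) :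
    ‖twistedMoment D 2 t - Real.exp (-t ^ 2 / 2)‖
      ≤ ((∫ y, |y| ^ 3 * Real.exp |y| ∂D) + 1) * |t| := by
  have h := norm_twistedMoment_sub_sum_le hD (k := 2) (r := 1) rfl ht
  have h2 : ∫ y : ℝ, (y : ℂ) ^ 2 ∂D = 1 := by
    simp_rw [← Complex.ofReal_pow]; simp [integral_complex_ofReal, hvar, -Complex.ofReal_pow]
  have h3 : ∑ i ∈ Finset.range 1,
      (t * Complex.I) ^ i / (i.factorial : ℂ) * ∫ y : ℝ, (y : ℂ) ^ (2 + i) ∂D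
      = ((1 : ℝ) : ℂ) := by
    simp [h2]
  rw [h3, pow_one] at h
  have h4 := abs_exp_neg_half_sq_sub_one_le ht
  rw [← Real.norm_eq_abs, ← Complex.norm_real, Complex.ofReal_sub, norm_sub_rev] at h4
  have := norm_sub_le_norm_sub_add_norm_sub (twistedMoment D 2 t) ((1 : ℝ) : ℂ)
    (Real.exp (-t ^ 2 / 2) : ℂ)
  linarith

/-- Centring allows `exp (i t y)` to be replaced by `exp (i t y) - 1`, of modulus at most `|t y|`.
Unit variance makes the constant exactly `1`, as the comparison of products requires. -/
theorem norm_twistedMoment_one_le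
    (hD : ProbabilityTheory.HasSubgaussianMGF (fun t : ℝ => t) K D)
    (hmean : ∫ t, t ∂D = 0) (hvar : ∫ t, t ^ 2 ∂D = 1) (t : ℝ) :
    ‖twistedMoment D 1 t‖ ≤ |t| := by
  have h1 : ∫ y : ℝ, (y : ℂ) ^ 1 ∂D = 0 := by
    simpa [hmean] using integral_complex_ofReal (μ := D) (f := fun y : ℝ => y)
  rw [← sub_zero (twistedMoment D 1 t), ← h1, twistedMoment,
    ← integral_sub (integrable_twisted hD 1 t) (integrable_ofReal_pow hD 1)]
  have h2 : |t| = ∫ y : ℝ, |t| * |y| ^ 2 ∂D := by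
    rw [integral_const_mul]; simp [hvar]
  rw [h2]
  refine norm_integral_le_of_norm_le ((integrable_abs_pow hD 2).const_mul _)
    (ae_of_all _ fun y => ?_)
  have h3 := Real.norm_exp_I_mul_ofReal_sub_one_le (x := t * y)
  rw [Complex.ofReal_mul, mul_comm Complex.I, Real.norm_eq_abs, abs_mul] at h3
  rw [← mul_sub_one, norm_mul, pow_one, Complex.norm_real, Real.norm_eq_abs]
  calc |y| * _ ≤ |y| * (|t| * |y|) := by gcongr
    _ = _ := by ring

/-- Dividing out `i t` leaves a factor comparable to the Gaussian one. In an off-diagonal entry the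
two extracted factors multiply to `-x_j x_k`, so the error there is relative to `|x_j| |x_k|`; an
absolute error would not sum over the entries. -/
theorem exists_twistedMoment_one_eq
    (hD : ProbabilityTheory.HasSubgaussianMGF (fun t : ℝ => t) K D)
    (hmean : ∫ t, t ∂D = 0) (hvar : ∫ t, t ^ 2 ∂D = 1) {t : ℝ} (ht : |t| ≤ 1) :
    ∃ ρ : ℂ, ‖ρ‖ ≤ 1 ∧ twistedMoment D 1 t = t * Complex.I * ρ ∧
      ‖ρ - Real.exp (-t ^ 2 / 2)‖ ≤ ((∫ y, |y| ^ 3 * Real.exp |y| ∂D) + 1) * |t| := by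
  have hle := norm_twistedMoment_one_le hD hmean hvar t
  rcases eq_or_ne t 0 with rfl | ht0
  · refine ⟨1, by simp, ?_, by simp⟩
    simpa using hle
  have ht0' : (t : ℂ) * Complex.I ≠ 0 := mul_ne_zero (by exact_mod_cast ht0) Complex.I_ne_zero
  have hn : ‖(t : ℂ) * Complex.I‖ = |t| := by simp
  have htp : 0 < |t| := abs_pos.mpr ht0
  refine ⟨twistedMoment D 1 t / (t * Complex.I), ?_, (mul_div_cancel₀ _ ht0').symm, ?_⟩
  · rw [norm_div, hn, div_le_one htp]
    exact hle
  have h := norm_twistedMoment_sub_sum_le hD (k := 1) (r := 2) rfl ht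
  have h1 : ∫ y : ℝ, (y : ℂ) ∂D = 0 := by
    simpa [hmean] using integral_complex_ofReal (μ := D) (f := fun y : ℝ => y)
  have h2 : ∫ y : ℝ, (y : ℂ) ^ 2 ∂D = 1 := by
    simp_rw [← Complex.ofReal_pow]; simp [integral_complex_ofReal, hvar, -Complex.ofReal_pow]
  have h3 : ∑ i ∈ Finset.range 2,
      (t * Complex.I) ^ i / (i.factorial : ℂ) * ∫ y : ℝ, (y : ℂ) ^ (1 + i) ∂D
      = t * Complex.I := by
    simp [Finset.sum_range_succ, h1, h2]
  rw [h3] at h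
  have h5 : ‖twistedMoment D 1 t / (t * Complex.I) - ((1 : ℝ) : ℂ)‖
      ≤ (∫ y, |y| ^ 3 * Real.exp |y| ∂D) * |t| := by
    rw [Complex.ofReal_one, div_sub_one ht0', norm_div, hn, div_le_iff₀ htp]
    linarith
  have h4 := abs_exp_neg_half_sq_sub_one_le ht
  rw [← Real.norm_eq_abs, ← Complex.norm_real, Complex.ofReal_sub, norm_sub_rev] at h4
  have := norm_sub_le_norm_sub_add_norm_sub (twistedMoment D 1 t / (t * Complex.I))
    ((1 : ℝ) : ℂ) (Real.exp (-t ^ 2 / 2) : ℂ)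
  linarith

end moments

/-! ### Gaussian comparison for flat vectors -/

/-- Telescoping: factors are exchanged one at a time, and those bounded by `1` do not amplify the
error. -/
theorem norm_prod_sub_prod_le_sum {ι : Type*} (s : Finset ι) (f g : ι → ℂ)
    (hf : ∀ i ∈ s, ‖f i‖ ≤ 1) (hg : ∀ i ∈ s, ‖g i‖ ≤ 1) :
    ‖∏ i ∈ s, f i - ∏ i ∈ s, g i‖ ≤ ∑ i ∈ s, ‖f i - g i‖ := by
  classical
  induction s using Finset.induction_on with
  | empty => simp
  | insert i s hi ih =>
    rw [Finset.prod_insert hi, Finset.prod_insert hi, Finset.sum_insert hi]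
    have h1 := ih (fun j hj => hf j (Finset.mem_insert_of_mem hj))
      (fun j hj => hg j (Finset.mem_insert_of_mem hj))
    have h2 : ‖∏ j ∈ s, f j‖ ≤ 1 := by
      rw [norm_prod]
      exact Finset.prod_le_one (fun _ _ => norm_nonneg _)
        fun j hj => hf j (Finset.mem_insert_of_mem hj)
    have h3 := hg i (Finset.mem_insert_self i s)
    calc ‖f i * ∏ j ∈ s, f j - g i * ∏ j ∈ s, g j‖
        = ‖(f i - g i) * ∏ j ∈ s, f j + g i * (∏ j ∈ s, f j - ∏ j ∈ s, g j)‖ := by ring_nf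
      _ ≤ ‖f i - g i‖ * ‖∏ j ∈ s, f j‖ + ‖g i‖ * ‖∏ j ∈ s, f j - ∏ j ∈ s, g j‖ := by
          refine (norm_add_le _ _).trans_eq ?_
          rw [norm_mul, norm_mul]
      _ ≤ ‖f i - g i‖ * 1 + 1 * ∑ j ∈ s, ‖f j - g j‖ := by gcongr
      _ = _ := by ring

/-- The exponent of the `l`-th coordinate in the monomial `a_j a_k`. -/
def pairExponent {n : ℕ} (j k l : Fin n) : ℕ := (if l = j then 1 else 0) + (if l = k then 1 else 0)

theorem exp_dotProduct_mul_mul_eq_prod {n : ℕ} (x a : Fin n → ℝ) (j k : Fin n) :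
    Complex.exp (((x ⬝ᵥ a : ℝ) : ℂ) * Complex.I) * (a j : ℂ) * (a k : ℂ) =
      ∏ l, (a l : ℂ) ^ pairExponent j k l * Complex.exp (x l * a l * Complex.I) := by
  rw [Finset.prod_mul_distrib, ← Complex.exp_sum, ← Finset.sum_mul]
  simp only [pairExponent, pow_add, Finset.prod_mul_distrib]
  have h : ∀ i : Fin n, ∏ l, (a l : ℂ) ^ (if l = i then 1 else 0) = a i := fun i => by
    simp [pow_ite]
  rw [h, h, dotProduct]
  push_cast
  ring

section bias

variable {D : Measure ℝ} [IsProbabilityMeasure D] {K : NNReal}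

theorem integrable_exp_dotProduct_mul_mul
    (hD : ProbabilityTheory.HasSubgaussianMGF (fun t : ℝ => t) K D) {n : ℕ} (x : Fin n → ℝ)
    (j k : Fin n) :
    Integrable (fun a : Fin n → ℝ =>
      Complex.exp (((x ⬝ᵥ a : ℝ) : ℂ) * Complex.I) * (a j : ℂ) * (a k : ℂ))
      (Measure.pi fun _ => D) := by
  simp_rw [exp_dotProduct_mul_mul_eq_prod]
  exact Integrable.fintype_prod
    (f := fun l (y : ℝ) => (y : ℂ) ^ pairExponent j k l * Complex.exp (x l * y * Complex.I))
    fun l => integrable_twisted hD _ _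

theorem integral_exp_dotProduct_mul_mul {n : ℕ} (x : Fin n → ℝ) (j k : Fin n) :
    ∫ a : Fin n → ℝ, Complex.exp (((x ⬝ᵥ a : ℝ) : ℂ) * Complex.I) * (a j : ℂ) * (a k : ℂ)
      ∂(Measure.pi fun _ => D) = ∏ l, twistedMoment D (pairExponent j k l) (x l) := by
  simp_rw [exp_dotProduct_mul_mul_eq_prod]
  exact integral_fintype_prod_eq_prod
    (fun l (y : ℝ) => (y : ℂ) ^ pairExponent j k l * Complex.exp (x l * y * Complex.I))

/-- Comparison of a product of factors close to `exp (-x_l² / 2)` with the Gaussian product,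
where two factors may be off by a larger amount. -/
theorem norm_prod_sub_exp_le {n : ℕ} {x : Fin n → ℝ} {μ C : ℝ} (hC : 0 ≤ C)
    (hx : ∑ l, x l ^ 2 ≤ 1) (hμ : ∀ l, |x l| ≤ μ) (j k : Fin n) (h : Fin n → ℂ)
    (h1 : ∀ l, ‖h l‖ ≤ 1)
    (h2 : ∀ l, l ≠ j → l ≠ k → ‖h l - Real.exp (-x l ^ 2 / 2)‖ ≤ C * |x l| ^ 3)
    (h3 : ∀ l, l = j ∨ l = k → ‖h l - Real.exp (-x l ^ 2 / 2)‖ ≤ C * |x l|) :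
    ‖∏ l, h l - Real.exp (-(∑ l, x l ^ 2) / 2)‖ ≤ 3 * C * μ := by
  have hμ0 : 0 ≤ μ := (abs_nonneg _).trans (hμ j)
  have he : ((Real.exp (-(∑ l, x l ^ 2) / 2) : ℝ) : ℂ) =
      ∏ l, ((Real.exp (-x l ^ 2 / 2) : ℝ) : ℂ) := by
    rw [← Complex.ofReal_prod, ← Real.exp_sum, ← Finset.sum_div, Finset.sum_neg_distrib]
  rw [he]
  refine (norm_prod_sub_prod_le_sum _ _ _ (fun l _ => h1 l) fun l _ => ?_).trans ?_
  · rw [Complex.norm_real, Real.norm_eq_abs, abs_of_pos (Real.exp_pos _), Real.exp_le_one_iff]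
    nlinarith [sq_nonneg (x l)]
  -- Flatness gives `∑ |x_l|³ ≤ μ ∑ x_l² ≤ μ`; each exceptional coordinate adds at most `C μ`,
  -- whence the `3`.
  calc ∑ l, ‖h l - Real.exp (-x l ^ 2 / 2)‖
      ≤ ∑ l, (C * μ * x l ^ 2 + ((if l = j then C * μ else 0) + if l = k then C * μ else 0)) := by
        refine Finset.sum_le_sum fun l _ => ?_
        have hCμ : 0 ≤ C * μ := by positivity
        have hq : 0 ≤ C * μ * x l ^ 2 := by positivity
        have hl : C * |x l| ≤ C * μ := mul_le_mul_of_nonneg_left (hμ l) hC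
        by_cases hj : l = j
        · have := h3 l (Or.inl hj)
          rw [if_pos hj]
          split_ifs <;> linarith
        · by_cases hk : l = k
          · have := h3 l (Or.inr hk)
            rw [if_pos hk]
            split_ifs; linarith
          · rw [if_neg hj, if_neg hk, add_zero, add_zero]
            refine (h2 l hj hk).trans ?_
            calc C * |x l| ^ 3 = C * |x l| * x l ^ 2 := by rw [← sq_abs (x l)]; ring
              _ ≤ C * μ * x l ^ 2 := by gcongr
    _ = C * μ * ∑ l, x l ^ 2 + (C * μ + C * μ) := by
        rw [Finset.sum_add_distrib, Finset.sum_add_distrib, ← Finset.mul_sum]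
        simp
    _ ≤ 3 * C * μ := by
        have hCμ : 0 ≤ C * μ := by positivity
        nlinarith

theorem norm_twistedMoment_zero_le (t : ℝ) : ‖twistedMoment D 0 t‖ ≤ 1 :=
  (norm_twistedMoment_le 0 t).trans (by simp)

theorem norm_twistedMoment_two_le (hvar : ∫ t, t ^ 2 ∂D = 1) (t : ℝ) :
    ‖twistedMoment D 2 t‖ ≤ 1 :=
  (norm_twistedMoment_le 2 t).trans (by simp [hvar])

/-- Entrywise comparison of `E exp(i⟨x,a⟩) a aᵀ` with `exp(-|x|²/2) (I - x xᵀ)`. -/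
theorem norm_prod_twistedMoment_sub_le
    (hD : ProbabilityTheory.HasSubgaussianMGF (fun t : ℝ => t) K D)
    (hmean : ∫ t, t ∂D = 0) (hvar : ∫ t, t ^ 2 ∂D = 1) {n : ℕ} {x : Fin n → ℝ} {μ : ℝ}
    (hx : ∑ l, x l ^ 2 ≤ 1) (hμ : ∀ l, |x l| ≤ μ) (hμ1 : μ ≤ 1) (j k : Fin n) :
    ‖∏ l, twistedMoment D (pairExponent j k l) (x l)
        - ((Real.exp (-(∑ l, x l ^ 2) / 2) * ((if j = k then 1 else 0) - x j * x k) : ℝ) : ℂ)‖ ≤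
      (3 * ((∫ y, |y| ^ 3 * Real.exp |y| ∂D) + 1) + 1) * μ *
        ((if j = k then 1 else 0) + |x j| * |x k|) := by
  set C := (∫ y, |y| ^ 3 * Real.exp |y| ∂D) + 1 with hC
  have hC0 : 0 ≤ C := by
    have : 0 ≤ ∫ y, |y| ^ 3 * Real.exp |y| ∂D := integral_nonneg fun y => by positivity
    linarith
  have hμ0 : 0 ≤ μ := (abs_nonneg _).trans (hμ j)
  have hx1 : ∀ l, |x l| ≤ 1 := fun l => (hμ l).trans hμ1
  set E := Real.exp (-(∑ l, x l ^ 2) / 2) with hE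
  have hE0 : 0 < E := Real.exp_pos _
  have hE1 : E ≤ 1 := by
    rw [hE, Real.exp_le_one_iff]
    have : 0 ≤ ∑ l, x l ^ 2 := Finset.sum_nonneg fun l _ => sq_nonneg _
    linarith
  rcases eq_or_ne j k with rfl | hjk
  · have key := norm_prod_sub_exp_le hC0 hx hμ j j
      (fun l => twistedMoment D (pairExponent j j l) (x l)) (fun l => ?_) (fun l hl _ => ?_)
      (fun l hl => ?_)
    · simp only [if_true]
      -- On the diagonal the product is close to `E`, and passing to `E (1 - x_j²)` accounts for the
      -- extra `1` in the constant.
      have h1 : ‖((E - E * (1 - x j * x j) : ℝ) : ℂ)‖ ≤ μ * |x j| := by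
        rw [Complex.norm_real, Real.norm_eq_abs,
          show E - E * (1 - x j * x j) = E * (x j * x j) by ring, abs_mul, abs_mul,
          abs_of_pos hE0]
        calc E * (|x j| * |x j|) ≤ 1 * (μ * |x j|) := by gcongr; exact hμ j
          _ = _ := one_mul _
      rw [Complex.ofReal_sub] at h1
      have h2 := norm_sub_le_norm_sub_add_norm_sub
        (∏ l, twistedMoment D (pairExponent j j l) (x l)) (E : ℂ)
        ((E * (1 - x j * x j) : ℝ) : ℂ)
      have h3 : 0 ≤ (3 * C + 1) * μ * (|x j| * |x j|) := by positivity
      have h4 : μ * |x j| ≤ μ * 1 := mul_le_mul_of_nonneg_left (hx1 j) hμ0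
      linarith
    · by_cases hl : l = j
      · simpa [pairExponent, hl] using norm_twistedMoment_two_le hvar (x j)
      · simpa [pairExponent, hl] using norm_twistedMoment_zero_le (x l)
    · simpa [pairExponent, hl] using norm_twistedMoment_zero_sub_le hD hmean hvar (hx1 l)
    · have hl' : l = j := by simpa using hl
      subst hl'
      simpa [pairExponent] using norm_twistedMoment_two_sub_le hD hvar (hx1 l)
  · choose ρ hρ1 hρ2 hρ3 using fun l => exists_twistedMoment_one_eq hD hmean hvar (hx1 l)
    have hexp : ∀ l, (l = j ∨ l = k) → pairExponent j k l = 1 := by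
      rintro l (rfl | rfl)
      · simp [pairExponent, hjk]
      · simp [pairExponent, hjk.symm]
    have hexp' : ∀ l, ¬ (l = j ∨ l = k) → pairExponent j k l = 0 := by
      intro l hl
      rw [not_or] at hl
      simp [pairExponent, hl]
    classical
    -- The factors that remain after `i x_j` and `i x_k` are extracted.
    set h : Fin n → ℂ := fun l => if l = j ∨ l = k then ρ l else twistedMoment D 0 (x l) with hh
    have key := norm_prod_sub_exp_le hC0 hx hμ j k h (fun l => ?_) (fun l hl hl' => ?_)
      (fun l hl => ?_)
    · have hfac : ∏ l, twistedMoment D (pairExponent j k l) (x l) =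
          -((x j : ℂ) * x k) * ∏ l, h l := by
        have h1 : ∀ l, twistedMoment D (pairExponent j k l) (x l) =
            (if l = j then (x j : ℂ) * Complex.I else 1) *
              (if l = k then (x k : ℂ) * Complex.I else 1) * h l := by
          intro l
          by_cases hl : l = j ∨ l = k
          · rw [hexp l hl, hρ2, hh]
            simp only [if_pos hl]
            rcases hl with rfl | rfl
            · simp [hjk]
            · simp [hjk.symm]
          · rw [hexp' l hl, hh]
            simp only [if_neg hl]
            rw [not_or] at hl
            simp [hl]
        simp_rw [h1, Finset.prod_mul_distrib]
        simp only [Finset.prod_ite_eq', Finset.mem_univ, if_true]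
        linear_combination ((x j : ℂ) * x k) * (∏ l, h l) * Complex.I_mul_I
      rw [hfac, if_neg hjk]
      have h2 : -((x j : ℂ) * x k) * ∏ l, h l - ((E * (0 - x j * x k) : ℝ) : ℂ) =
          ((-(x j * x k) : ℝ) : ℂ) * (∏ l, h l - (E : ℂ)) := by
        push_cast
        ring
      rw [h2, norm_mul, Complex.norm_real, Real.norm_eq_abs, abs_neg, abs_mul]
      have h3 : 0 ≤ μ * (|x j| * |x k|) := by positivity
      have h4 := mul_le_mul_of_nonneg_left key (show 0 ≤ |x j| * |x k| by positivity)
      linarith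
    · simp only [hh]
      split_ifs
      · exact hρ1 l
      · exact norm_twistedMoment_zero_le _
    · simp only [hh, hl, hl', or_self, if_false]
      exact norm_twistedMoment_zero_sub_le hD hmean hvar (hx1 l)
    · simp only [hh, if_pos hl]
      exact hρ3 l

theorem sum_abs_mul_abs_le_one {n : ℕ} {u v : Fin n → ℝ} (hu : ∑ j, u j ^ 2 ≤ 1)
    (hv : ∑ j, v j ^ 2 ≤ 1) : ∑ j, |u j| * |v j| ≤ 1 := by
  have h : ∑ j, |u j| * |v j| ≤ ∑ j, (u j ^ 2 + v j ^ 2) / 2 := by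
    refine Finset.sum_le_sum fun j _ => ?_
    nlinarith [sq_nonneg (|u j| - |v j|), sq_abs (u j), sq_abs (v j)]
  rw [← Finset.sum_div, Finset.sum_add_distrib] at h
  linarith

/-- For flat `x`, the matrix `E cos⟨x,a⟩ a aᵀ` is close to `exp(-|x|²/2) (I - x xᵀ)`. -/
theorem abs_integral_cos_bilinear_sub_le
    (hD : ProbabilityTheory.HasSubgaussianMGF (fun t : ℝ => t) K D)
    (hmean : ∫ t, t ∂D = 0) (hvar : ∫ t, t ^ 2 ∂D = 1) {n : ℕ} {x : Fin n → ℝ} {μ : ℝ}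
    (hx : ∑ l, x l ^ 2 ≤ 1) (hμ : ∀ l, |x l| ≤ μ) (hμ0 : 0 ≤ μ) (hμ1 : μ ≤ 1) {u v : Fin n → ℝ}
    (hu : ∑ j, u j ^ 2 ≤ 1) (hv : ∑ j, v j ^ 2 ≤ 1) :
    |∫ a : Fin n → ℝ, Real.cos (x ⬝ᵥ a) * (u ⬝ᵥ a) * (v ⬝ᵥ a) ∂(Measure.pi fun _ => D)
      - Real.exp (-(∑ l, x l ^ 2) / 2) * (u ⬝ᵥ v - (x ⬝ᵥ u) * (x ⬝ᵥ v))| ≤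
      2 * (3 * ((∫ y, |y| ^ 3 * Real.exp |y| ∂D) + 1) + 1) * μ := by
  set C := 3 * ((∫ y, |y| ^ 3 * Real.exp |y| ∂D) + 1) + 1 with hC
  have hC0 : 0 ≤ C := by
    have : 0 ≤ ∫ y, |y| ^ 3 * Real.exp |y| ∂D := integral_nonneg fun y => by positivity
    linarith
  set P : Measure (Fin n → ℝ) := Measure.pi fun _ => D with hP
  set E := Real.exp (-(∑ l, x l ^ 2) / 2) with hE
  set F : Fin n → Fin n → (Fin n → ℝ) → ℂ := fun j k a =>
    Complex.exp (((x ⬝ᵥ a : ℝ) : ℂ) * Complex.I) * (a j : ℂ) * (a k : ℂ) with hF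
  have hFi : ∀ j k, Integrable (fun a => ((u j * v k : ℝ) : ℂ) * F j k a) P := fun j k =>
    (integrable_exp_dotProduct_mul_mul hD x j k).const_mul _
  have hpt : ∀ a : Fin n → ℝ, Real.cos (x ⬝ᵥ a) * (u ⬝ᵥ a) * (v ⬝ᵥ a) =
      (∑ j, ∑ k, ((u j * v k : ℝ) : ℂ) * F j k a).re := by
    intro a
    have h1 : ∑ j, ∑ k, ((u j * v k : ℝ) : ℂ) * F j k a =
        (((u ⬝ᵥ a) * (v ⬝ᵥ a) : ℝ) : ℂ) * Complex.exp (((x ⬝ᵥ a : ℝ) : ℂ) * Complex.I) := by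
      rw [dotProduct, dotProduct, Finset.sum_mul_sum]
      push_cast
      rw [Finset.sum_mul]
      refine Finset.sum_congr rfl fun j _ => ?_
      rw [Finset.sum_mul]
      refine Finset.sum_congr rfl fun k _ => ?_
      simp only [hF]
      ring
    rw [h1, Complex.re_ofReal_mul, Complex.exp_ofReal_mul_I_re]
    ring
  have hint : ∫ a, Real.cos (x ⬝ᵥ a) * (u ⬝ᵥ a) * (v ⬝ᵥ a) ∂P =
      (∑ j, ∑ k, ((u j * v k : ℝ) : ℂ) *
        ∏ l, twistedMoment D (pairExponent j k l) (x l)).re := by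
    simp_rw [hpt]
    have h2 : Integrable (fun a => ∑ j, ∑ k, ((u j * v k : ℝ) : ℂ) * F j k a) P :=
      integrable_finsetSum _ fun j _ => integrable_finsetSum _ fun k _ => hFi j k
    have h3 : ∫ a, (∑ j, ∑ k, ((u j * v k : ℝ) : ℂ) * F j k a).re ∂P =
        (∫ a, ∑ j, ∑ k, ((u j * v k : ℝ) : ℂ) * F j k a ∂P).re := integral_re h2
    rw [h3, integral_finsetSum _ fun j _ => integrable_finsetSum _ fun k _ => hFi j k]
    congr 1
    refine Finset.sum_congr rfl fun j _ => ?_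
    rw [integral_finsetSum _ fun k _ => hFi j k]
    refine Finset.sum_congr rfl fun k _ => ?_
    rw [integral_const_mul, hF, integral_exp_dotProduct_mul_mul]
  have htar : E * (u ⬝ᵥ v - (x ⬝ᵥ u) * (x ⬝ᵥ v)) =
      (∑ j, ∑ k, ((u j * v k : ℝ) : ℂ) *
        ((E * ((if j = k then 1 else 0) - x j * x k) : ℝ) : ℂ)).re := by
    simp_rw [← Complex.ofReal_mul, ← Complex.ofReal_sum, Complex.ofReal_re]
    rw [dotProduct, dotProduct, dotProduct, Finset.sum_mul_sum]
    have h4 : ∀ j, u j * v j = ∑ k, u j * v k * (if j = k then 1 else 0) := fun j => by simp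
    simp_rw [h4, ← Finset.sum_sub_distrib, Finset.mul_sum]
    refine Finset.sum_congr rfl fun j _ => Finset.sum_congr rfl fun k _ => ?_
    ring
  rw [hint, htar, ← Complex.sub_re, ← Finset.sum_sub_distrib]
  refine (Complex.abs_re_le_norm _).trans ?_
  -- The error matrix is dominated entrywise by `C μ (I + |x| |x|ᵀ)`, whose bilinear form on the
  -- unit ball is at most `2 C μ`, independently of `n`.
  calc _ ≤ ∑ j, ∑ k, |u j| * |v k| * (C * μ * ((if j = k then 1 else 0) + |x j| * |x k|)) := by
        refine (norm_sum_le _ _).trans (Finset.sum_le_sum fun j _ => ?_)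
        rw [← Finset.sum_sub_distrib]
        refine (norm_sum_le _ _).trans (Finset.sum_le_sum fun k _ => ?_)
        rw [← mul_sub, norm_mul, Complex.norm_real, Real.norm_eq_abs, abs_mul]
        gcongr
        exact norm_prod_twistedMoment_sub_le hD hmean hvar hx hμ hμ1 j k
    _ = C * μ * (∑ j, |u j| * |v j| + (∑ j, |u j| * |x j|) * ∑ k, |v k| * |x k|) := by
        have h4 : ∀ j, |u j| * |v j| = ∑ k, |u j| * |v k| * (if j = k then 1 else 0) :=
          fun j => by simp
        simp_rw [h4]
        rw [Finset.sum_mul_sum, ← Finset.sum_add_distrib, Finset.mul_sum]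
        refine Finset.sum_congr rfl fun j _ => ?_
        rw [← Finset.sum_add_distrib, Finset.mul_sum]
        refine Finset.sum_congr rfl fun k _ => ?_
        ring
    _ ≤ C * μ * (1 + 1 * 1) := by
        have h5 := sum_abs_mul_abs_le_one hu hv
        have h6 := sum_abs_mul_abs_le_one hu hx
        have h7 := sum_abs_mul_abs_le_one hv hx
        gcongr
    _ = _ := by ring

end bias

/-! ### Nets, operator norms and the adjoint -/

/-- The unit ball has a `1/2`-net of cardinality at most `5 ^ dim`. -/
theorem exists_half_net (E : Type*) [NormedAddCommGroup E] [NormedSpace ℝ E]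
    [FiniteDimensional ℝ E] :
    ∃ N : Finset E, N.card ≤ 5 ^ Module.finrank ℝ E ∧ (∀ u ∈ N, ‖u‖ ≤ 1) ∧
      ∀ x : E, ‖x‖ ≤ 1 → ∃ u ∈ N, ‖x - u‖ ≤ 1 / 2 := by
  classical
  let Q : Finset E → Prop := fun s => (∀ c ∈ s, ‖c‖ ≤ 1) ∧
    ∀ c ∈ s, ∀ d ∈ s, c ≠ d → 1 / 2 < ‖c - d‖
  have hcard : ∀ s, Q s → s.card ≤ 5 ^ Module.finrank ℝ E := by
    intro s hs
    -- Doubling yields `1`-separated points in the ball of radius `2`, the setting of the packing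
    -- bound `5 ^ dim`.
    have hinj : Function.Injective fun c : E => (2 : ℝ) • c := smul_right_injective E two_ne_zero
    rw [← Finset.card_image_of_injective s hinj]
    apply Besicovitch.card_le_of_separated
    · simp only [Finset.mem_image]
      rintro _ ⟨c, hc, rfl⟩
      rw [norm_smul, Real.norm_two]
      linarith [hs.1 c hc]
    · simp only [Finset.mem_image]
      rintro _ ⟨c, hc, rfl⟩ _ ⟨d, hd, rfl⟩ hcd
      rw [← smul_sub, norm_smul, Real.norm_two]
      linarith [hs.2 c hc d hd fun h => hcd (by rw [h])]
  let R : ℕ → Prop := fun k => ∃ s, Q s ∧ s.card = k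
  have h0 : R 0 := ⟨∅, ⟨by simp, by simp⟩, rfl⟩
  -- A separated set of greatest size is a net: a point far from all of it could be added.
  obtain ⟨s, hs, hsc⟩ : R (Nat.findGreatest R (5 ^ Module.finrank ℝ E)) :=
    Nat.findGreatest_spec (Nat.zero_le _) h0
  refine ⟨s, hcard s hs, hs.1, fun x hx => ?_⟩
  by_contra! hfar
  have hxs : x ∉ s := fun h => by
    have := hfar x h
    rw [sub_self, norm_zero] at this
    linarith
  have hQ : Q (insert x s) := by
    refine ⟨fun c hc => ?_, fun c hc d hd hcd => ?_⟩
    · rcases Finset.mem_insert.mp hc with rfl | hc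
      · exact hx
      · exact hs.1 c hc
    · rcases Finset.mem_insert.mp hc with rfl | hc' <;> rcases Finset.mem_insert.mp hd with rfl | hd'
      · exact absurd rfl hcd
      · exact hfar d hd'
      · rw [norm_sub_rev]; exact hfar c hc'
      · exact hs.2 c hc' d hd' hcd
  have h1 : (insert x s).card = s.card + 1 := Finset.card_insert_of_notMem hxs
  have h2 := hcard _ hQ
  exact Nat.findGreatest_is_greatest (P := R) (n := 5 ^ Module.finrank ℝ E) (k := s.card + 1)
    (by omega) (by omega) ⟨_, hQ, h1⟩

/-- The operator norm is controlled by the bilinear form on a `1/2`-net. -/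
theorem opNorm_le_of_half_net {E : Type*} [NormedAddCommGroup E] [InnerProductSpace ℝ E]
    {N : Finset E} (hN : ∀ x : E, ‖x‖ ≤ 1 → ∃ u ∈ N, ‖x - u‖ ≤ 1 / 2) (A : E →L[ℝ] E) {δ : ℝ}
    (h : ∀ u ∈ N, ∀ v ∈ N, |inner ℝ (A u) v| ≤ δ) : ‖A‖ ≤ 4 * δ := by
  have hδ : 0 ≤ δ := by
    obtain ⟨u, hu, -⟩ := hN 0 (by simp)
    exact (abs_nonneg _).trans (h u hu u hu)
  -- Each use of the net costs a factor `2`: here in the direction of `A u`, then in the argument of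
  -- `A` through `‖A‖ ≤ 2δ + ‖A‖/2`.
  have h1 : ∀ u ∈ N, ‖A u‖ ≤ 2 * δ := by
    intro u hu
    rcases eq_or_ne (A u) 0 with h0 | h0
    · rw [h0, norm_zero]; positivity
    have hpos : 0 < ‖A u‖ := norm_pos_iff.mpr h0
    obtain ⟨v, hv, hd⟩ := hN (‖A u‖⁻¹ • A u) (by
      rw [norm_smul, norm_inv, norm_norm, inv_mul_cancel₀ hpos.ne'])
    have h2 : inner ℝ (A u) (‖A u‖⁻¹ • A u) = ‖A u‖ := by
      rw [inner_smul_right, real_inner_self_eq_norm_sq]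
      field_simp
    have h3 : inner ℝ (A u) (‖A u‖⁻¹ • A u - v) ≤ ‖A u‖ * (1 / 2) :=
      (real_inner_le_norm _ _).trans (by gcongr)
    rw [inner_sub_right, h2] at h3
    have h4 := (le_abs_self _).trans (h u hu v hv)
    linarith
  have h2 : ‖A‖ ≤ 2 * δ + ‖A‖ / 2 := by
    refine ContinuousLinearMap.opNorm_le_of_unit_norm (by positivity) fun x hx => ?_
    obtain ⟨u, hu, hd⟩ := hN x hx.le
    calc ‖A x‖ = ‖A u + A (x - u)‖ := by rw [← map_add, add_sub_cancel]
      _ ≤ ‖A u‖ + ‖A (x - u)‖ := norm_add_le _ _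
      _ ≤ 2 * δ + ‖A‖ * (1 / 2) := by
          refine add_le_add (h1 u hu) ((A.le_opNorm _).trans (by gcongr))
      _ = _ := by ring
  linarith

theorem inner_toEuclideanCLM {n : ℕ} (M : Matrix (Fin n) (Fin n) ℝ)
    (u v : EuclideanSpace ℝ (Fin n)) :
    inner ℝ (Matrix.toEuclideanCLM (n := Fin n) (𝕜 := ℝ) M u) v = (M.mulVec u.ofLp) ⬝ᵥ v.ofLp := by
  rw [EuclideanSpace.inner_eq_star_dotProduct, dotProduct_comm]
  simp

theorem norm_toLp_mulVec_le {n : ℕ} (M : Matrix (Fin n) (Fin n) ℝ) (x : Fin n → ℝ) :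
    ‖WithLp.toLp 2 (M.mulVec x)‖ ≤ spectralNorm₂ M * ‖WithLp.toLp 2 x‖ := by
  have h := (Matrix.toEuclideanCLM (n := Fin n) (𝕜 := ℝ) M).le_opNorm (WithLp.toLp 2 x)
  rwa [Matrix.toEuclideanCLM_toLp] at h

theorem adjoint_samplingOp {n m : ℕ} (a : Fin m → Fin n → ℝ) (l : Fin m → ℝ) :
    (samplingOp a).adjoint (WithLp.toLp 2 l) = ∑ i, l i • Matrix.vecMulVec (a i) (a i) := by
  refine ext_inner_right ℝ fun X => ?_
  rw [LinearMap.adjoint_inner_left, sum_inner, PiLp.inner_apply]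
  refine Finset.sum_congr rfl fun i _ => ?_
  rw [real_inner_smul_left]
  have h : inner ℝ (Matrix.vecMulVec (a i) (a i)) X =
      ((Matrix.vecMulVec (a i) (a i)).transpose * X).trace := rfl
  rw [h, Matrix.transpose_vecMulVec]
  simp [samplingOp, mul_comm]

/-! ### Projections onto the tangent space and its complement -/

section projection

variable {n : ℕ} {x : Fin n → ℝ}

/-- The projection onto the orthogonal complement of `x`, for `x` a unit vector or zero. -/
def complProj (x : Fin n → ℝ) : Matrix (Fin n) (Fin n) ℝ := 1 - Matrix.vecMulVec x x

theorem transpose_complProj : (complProj x).transpose = complProj x := by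
  rw [complProj, Matrix.transpose_sub, Matrix.transpose_one, Matrix.transpose_vecMulVec]

/-- The hypothesis holds exactly for unit vectors and for zero, so `x₀ = 0` needs no separate
treatment. -/
theorem complProj_mulVec_self (hx : (x ⬝ᵥ x) • x = x) : (complProj x).mulVec x = 0 := by
  rw [complProj, Matrix.sub_mulVec, Matrix.one_mulVec, Matrix.vecMulVec_mulVec]
  simp [hx]

theorem complProj_mul_self (hx : (x ⬝ᵥ x) • x = x) : complProj x * complProj x = complProj x := by
  conv_lhs => rhs; rw [complProj]
  rw [mul_sub, mul_one, Matrix.mul_vecMulVec, complProj_mulVec_self hx, Matrix.zero_vecMulVec,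
    sub_zero]

/-- A self-adjoint idempotent satisfies `‖A‖² = ‖A‖` by the C⋆-identity. -/
theorem spectralNorm₂_complProj_le (hx : (x ⬝ᵥ x) • x = x) : spectralNorm₂ (complProj x) ≤ 1 := by
  unfold spectralNorm₂
  set A := Matrix.toEuclideanCLM (n := Fin n) (𝕜 := ℝ) (complProj x) with hA
  have h1 : star A * A = A := by
    rw [hA, ← map_star, ← map_mul, Matrix.star_eq_conjTranspose,
      Matrix.conjTranspose_eq_transpose_of_trivial, transpose_complProj, complProj_mul_self hx]
  have h2 := CStarRing.norm_star_mul_self (x := A)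
  rw [h1] at h2
  nlinarith [norm_nonneg A, sq_nonneg (‖A‖ - 1)]

theorem spectralNorm₂_mul_le (M M' : Matrix (Fin n) (Fin n) ℝ) :
    spectralNorm₂ (M * M') ≤ spectralNorm₂ M * spectralNorm₂ M' := by
  unfold spectralNorm₂
  rw [map_mul]
  exact norm_mul_le _ _

theorem spectralNorm₂_nonneg (M : Matrix (Fin n) (Fin n) ℝ) : 0 ≤ spectralNorm₂ M := norm_nonneg _

theorem frobNorm_vecMulVec_le (u v : Fin n → ℝ) :
    frobNorm (Matrix.vecMulVec u v) ≤ ‖WithLp.toLp 2 u‖ * ‖WithLp.toLp 2 v‖ := by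
  unfold frobNorm
  rw [Matrix.vecMulVec_eq Unit]
  refine (Matrix.frobenius_norm_mul _ _).trans_eq ?_
  rw [Matrix.frobenius_norm_replicateCol, Matrix.frobenius_norm_replicateRow]

/-- The tangential part of `Y` in terms of the vector `w = Y x - (x · Y x) / 2 • x`. -/
theorem sub_complProj_mul_mul {Y : Matrix (Fin n) (Fin n) ℝ} (hY : Y.transpose = Y) :
    Y - complProj x * Y * complProj x =
      Matrix.vecMulVec (Y.mulVec x - ((x ⬝ᵥ Y.mulVec x) / 2) • x) x +
        Matrix.vecMulVec x (Y.mulVec x - ((x ⬝ᵥ Y.mulVec x) / 2) • x) := by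
  have h : Matrix.vecMul x Y = Y.mulVec x := by
    rw [← Matrix.mulVec_transpose, hY]
  rw [complProj, sub_mul, one_mul, Matrix.vecMulVec_mul, h, mul_sub, mul_one, sub_mul,
    Matrix.mul_vecMulVec, Matrix.vecMulVec_mul_vecMulVec]
  ext i j
  simp only [Matrix.vecMulVec_apply, Matrix.sub_apply, Matrix.add_apply,
    Pi.sub_apply, Pi.smul_apply, smul_eq_mul, dotProduct_comm (Y.mulVec x) x]
  ring

/-- With `Z = P Y P`, `P = complProj x`, the difference `Y - Z` lies in `T` and `Z` is orthogonal to
`T` because `Z x₀ = 0`; uniqueness of the decomposition identifies the projections. Symmetry of `Y`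
puts `Y - Z` in the form `w xᵀ + x wᵀ`. -/
theorem matProj_orthogonal {x₀ : Fin n → ℝ} {r s : ℝ} (hr : x₀ = r • x) (hs : x = s • x₀)
    (hx : (x ⬝ᵥ x) • x = x) {Y : Matrix (Fin n) (Fin n) ℝ} (hY : Y.transpose = Y) :
    matProj (tangentSpaceAt x₀) Y = Y - complProj x * Y * complProj x ∧
      matProj (tangentSpaceAt x₀)ᗮ Y = complProj x * Y * complProj x := by
  set Z := complProj x * Y * complProj x with hZ
  have hZt : Z.transpose = Z := by
    rw [hZ, Matrix.transpose_mul, Matrix.transpose_mul, transpose_complProj, hY, mul_assoc]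
  have hZx : Z.mulVec x₀ = 0 := by
    rw [hr, Matrix.mulVec_smul, hZ, ← Matrix.mulVec_mulVec, complProj_mulVec_self hx]
    simp
  have hmem : Y - Z ∈ tangentSpaceAt x₀ := by
    refine ⟨s • (Y.mulVec x - ((x ⬝ᵥ Y.mulVec x) / 2) • x), ?_⟩
    rw [hZ, sub_complProj_mul_mul hY]
    generalize Y.mulVec x - ((x ⬝ᵥ Y.mulVec x) / 2) • x = w
    rw [Matrix.smul_vecMulVec, Matrix.vecMulVec_smul, ← Matrix.vecMulVec_smul,
      ← Matrix.smul_vecMulVec, ← hs]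
  have horth : Z ∈ (tangentSpaceAt x₀)ᗮ := by
    rw [Submodule.mem_orthogonal']
    rintro _ ⟨z, rfl⟩
    change (Z.transpose * _).trace = 0
    rw [hZt, mul_add, Matrix.mul_vecMulVec, Matrix.mul_vecMulVec, hZx, Matrix.trace_add,
      Matrix.trace_vecMulVec, Matrix.trace_vecMulVec, zero_dotProduct, add_zero, dotProduct_comm,
      Matrix.dotProduct_mulVec, ← Matrix.mulVec_transpose, hZt, hZx, zero_dotProduct]
  have h1 : matProj (tangentSpaceAt x₀) Y = Y - Z := by
    refine Submodule.eq_starProjection_of_mem_orthogonal hmem ?_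
    rwa [sub_sub_cancel]
  refine ⟨h1, ?_⟩
  have h2 : matProj (tangentSpaceAt x₀)ᗮ Y = Y - matProj (tangentSpaceAt x₀) Y :=
    Submodule.starProjection_orthogonal_val Y
  rw [h2, h1, sub_sub_cancel]

/-- A symmetric matrix close to `-2 (I - x xᵀ)` in operator norm satisfies the norm bounds of a dual
certificate. -/
theorem certificate_bounds_of_spectralNorm₂_le {x₀ : Fin n → ℝ} {r s : ℝ} (hr : x₀ = r • x)
    (hs : x = s • x₀) (hx : (x ⬝ᵥ x) • x = x) (hx1 : ‖WithLp.toLp 2 x‖ ≤ 1)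
    {Y : Matrix (Fin n) (Fin n) ℝ} (hY : Y.transpose = Y) {δ : ℝ}
    (hδ : spectralNorm₂ (Y + (2 : ℝ) • complProj x) ≤ δ) :
    spectralNorm₂ (matProj (tangentSpaceAt x₀)ᗮ Y + (2 : ℝ) • matProj (tangentSpaceAt x₀)ᗮ 1) ≤ δ ∧
      frobNorm (matProj (tangentSpaceAt x₀) Y) ≤ 3 * δ := by
  obtain ⟨h1, h2⟩ := matProj_orthogonal hr hs hx hY
  have h3 := (matProj_orthogonal hr hs hx (Y := 1) Matrix.transpose_one).2
  have hP := spectralNorm₂_complProj_le hx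
  have hP0 := spectralNorm₂_nonneg (complProj x)
  set M := Y + (2 : ℝ) • complProj x with hM
  have hM0 := spectralNorm₂_nonneg M
  constructor
  · have h4 : matProj (tangentSpaceAt x₀)ᗮ Y + (2 : ℝ) • matProj (tangentSpaceAt x₀)ᗮ 1 =
        complProj x * M * complProj x := by
      rw [h2, h3, hM, mul_add, add_mul, mul_one, Matrix.mul_smul, Matrix.smul_mul,
        complProj_mul_self hx, complProj_mul_self hx]
    rw [h4]
    calc _ ≤ spectralNorm₂ (complProj x * M) * spectralNorm₂ (complProj x) :=
          spectralNorm₂_mul_le _ _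
      _ ≤ (spectralNorm₂ (complProj x) * spectralNorm₂ M) * spectralNorm₂ (complProj x) := by
          gcongr; exact spectralNorm₂_mul_le _ _
      _ ≤ (1 * spectralNorm₂ M) * 1 := by gcongr
      _ ≤ δ := by linarith
  -- The tangential part is `w xᵀ + x wᵀ` with `w` built from `Y x = M x`. Then `|w| ≤ δ + δ/2`, and
  -- two rank-one terms give `3 δ`.
  · have hMx : M.mulVec x = Y.mulVec x := by
      rw [hM, Matrix.add_mulVec, Matrix.smul_mulVec, complProj_mulVec_self hx]
      simp
    have hYx : ‖WithLp.toLp 2 (Y.mulVec x)‖ ≤ δ := by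
      rw [← hMx]
      refine (norm_toLp_mulVec_le _ _).trans ?_
      calc _ ≤ spectralNorm₂ M * 1 := by gcongr
        _ ≤ δ := by linarith
    have hin : |x ⬝ᵥ Y.mulVec x| ≤ δ := by
      have h5 := abs_real_inner_le_norm (WithLp.toLp 2 (Y.mulVec x)) (WithLp.toLp 2 x)
      rw [EuclideanSpace.inner_toLp_toLp] at h5
      simp only [star_trivial] at h5
      refine h5.trans ?_
      calc _ ≤ ‖WithLp.toLp 2 (Y.mulVec x)‖ * 1 := by gcongr
        _ ≤ δ := by linarith
    have hw : ‖WithLp.toLp 2 (Y.mulVec x - ((x ⬝ᵥ Y.mulVec x) / 2) • x)‖ ≤ 3 / 2 * δ := by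
      rw [WithLp.toLp_sub, WithLp.toLp_smul]
      refine (norm_sub_le _ _).trans ?_
      rw [norm_smul, Real.norm_eq_abs, abs_div, abs_two]
      have : |x ⬝ᵥ Y.mulVec x| / 2 * ‖WithLp.toLp 2 x‖ ≤ δ / 2 * 1 := by
        have := (abs_nonneg _).trans hin
        gcongr
      linarith
    rw [h1, sub_complProj_mul_mul hY]
    generalize Y.mulVec x - ((x ⬝ᵥ Y.mulVec x) / 2) • x = w at hw
    have h6 : frobNorm (Matrix.vecMulVec w x + Matrix.vecMulVec x w) ≤
        frobNorm (Matrix.vecMulVec w x) + frobNorm (Matrix.vecMulVec x w) := norm_add_le _ _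
    have h7 := frobNorm_vecMulVec_le w x
    have h8 := frobNorm_vecMulVec_le x w
    have h9 : ‖WithLp.toLp 2 w‖ * ‖WithLp.toLp 2 x‖ ≤ ‖WithLp.toLp 2 w‖ * 1 := by gcongr
    linarith

end projection

/-! ### The cosine-weighted certificate -/

instance isProbabilityMeasure_measurementLaw (D : Measure ℝ) [IsProbabilityMeasure D] (n m : ℕ) :
    IsProbabilityMeasure (measurementLaw D n m) := by
  unfold measurementLaw
  infer_instance

/-- The weight function of the dual certificate. -/
noncomputable def certificateWeight {n : ℕ} (x a : Fin n → ℝ) : ℝ :=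
  -(2 * Real.exp ((∑ l, x l ^ 2) / 2)) * Real.cos (x ⬝ᵥ a)

/-- Source of `B₀ = 4`: since `e ≤ 4`, `exp (1/2) ≤ 2`. -/
theorem two_mul_exp_half_le {n : ℕ} {x : Fin n → ℝ} (hx : ∑ l, x l ^ 2 ≤ 1) :
    2 * Real.exp ((∑ l, x l ^ 2) / 2) ≤ 4 := by
  have h1 : Real.exp ((∑ l, x l ^ 2) / 2) ≤ Real.exp (1 / 2) := by
    rw [Real.exp_le_exp]; linarith
  have h2 : Real.exp (1 / 2) * Real.exp (1 / 2) = Real.exp 1 := by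
    rw [← Real.exp_add]; norm_num
  nlinarith [Real.exp_one_lt_d9, Real.exp_pos (1 / 2)]

theorem abs_certificateWeight_le {n : ℕ} {x : Fin n → ℝ} (hx : ∑ l, x l ^ 2 ≤ 1)
    (a : Fin n → ℝ) : |certificateWeight x a| ≤ 4 := by
  have h := two_mul_exp_half_le hx
  rw [certificateWeight, abs_mul, abs_neg, abs_of_pos (by positivity)]
  nlinarith [Real.abs_cos_le_one (x ⬝ᵥ a), abs_nonneg (Real.cos (x ⬝ᵥ a)),
    Real.exp_pos ((∑ l, x l ^ 2) / 2)]

theorem measurable_certificateWeight {n : ℕ} (x : Fin n → ℝ) :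
    Measurable (certificateWeight x) := by
  have h1 : Measurable fun a : Fin n → ℝ => x ⬝ᵥ a := by
    unfold dotProduct; fun_prop
  exact (Real.measurable_cos.comp h1).const_mul _

/-- The expectation of the weighted bilinear form is close to that of `-2 (I - x xᵀ)`. -/
theorem abs_integral_certificateWeight_add_le {D : Measure ℝ} [IsProbabilityMeasure D] {K : NNReal}
    (hD : ProbabilityTheory.HasSubgaussianMGF (fun t : ℝ => t) K D)
    (hmean : ∫ t, t ∂D = 0) (hvar : ∫ t, t ^ 2 ∂D = 1) {n : ℕ} {x : Fin n → ℝ} {μ : ℝ}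
    (hx : ∑ l, x l ^ 2 ≤ 1) (hμ : ∀ l, |x l| ≤ μ) (hμ0 : 0 ≤ μ) (hμ1 : μ ≤ 1) {u v : Fin n → ℝ}
    (hu : ∑ j, u j ^ 2 ≤ 1) (hv : ∑ j, v j ^ 2 ≤ 1) :
    |∫ a : Fin n → ℝ, certificateWeight x a * (u ⬝ᵥ a) * (v ⬝ᵥ a) ∂(Measure.pi fun _ => D)
      + 2 * (u ⬝ᵥ v - (x ⬝ᵥ u) * (x ⬝ᵥ v))| ≤
      4 * (2 * (3 * ((∫ y, |y| ^ 3 * Real.exp |y| ∂D) + 1) + 1) * μ) := by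
  have h := abs_integral_cos_bilinear_sub_le hD hmean hvar hx hμ hμ0 hμ1 hu hv
  set J := ∫ a : Fin n → ℝ, Real.cos (x ⬝ᵥ a) * (u ⬝ᵥ a) * (v ⬝ᵥ a) ∂(Measure.pi fun _ => D)
  set S := ∑ l, x l ^ 2
  have h1 : ∫ a : Fin n → ℝ, certificateWeight x a * (u ⬝ᵥ a) * (v ⬝ᵥ a)
      ∂(Measure.pi fun _ => D) = -(2 * Real.exp (S / 2)) * J := by
    rw [← integral_const_mul]
    refine integral_congr_ae (ae_of_all _ fun a => ?_)
    simp only [certificateWeight]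
    ring
  have h2 : Real.exp (S / 2) * Real.exp (-S / 2) = 1 := by
    rw [← Real.exp_add, ← Real.exp_zero]; congr 1; ring
  have h3 : -(2 * Real.exp (S / 2)) * J + 2 * (u ⬝ᵥ v - (x ⬝ᵥ u) * (x ⬝ᵥ v)) =
      -((2 * Real.exp (S / 2)) * (J - Real.exp (-S / 2) * (u ⬝ᵥ v - (x ⬝ᵥ u) * (x ⬝ᵥ v)))) := by
    linear_combination (-2 * (u ⬝ᵥ v - (x ⬝ᵥ u) * (x ⬝ᵥ v))) * h2
  rw [h1, h3, abs_neg, abs_mul, abs_of_pos (by positivity)]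
  exact mul_le_mul (two_mul_exp_half_le hx) h (abs_nonneg _) (by norm_num)

/-- The candidate certificate. -/
noncomputable def certificate {n m : ℕ} (x : Fin n → ℝ) (a : Fin m → Fin n → ℝ) :
    Matrix (Fin n) (Fin n) ℝ :=
  ∑ i, (certificateWeight x (a i) / m) • Matrix.vecMulVec (a i) (a i)

theorem transpose_certificate {n m : ℕ} (x : Fin n → ℝ) (a : Fin m → Fin n → ℝ) :
    (certificate x a).transpose = certificate x a := by
  simp [certificate, Matrix.transpose_sum, Matrix.transpose_smul, Matrix.transpose_vecMulVec]

theorem certificate_add_mulVec_dotProduct {n m : ℕ} (x u v : Fin n → ℝ) (a : Fin m → Fin n → ℝ) :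
    ((certificate x a + (2 : ℝ) • complProj x).mulVec u) ⬝ᵥ v =
      (∑ i, certificateWeight x (a i) * (u ⬝ᵥ a i) * (v ⬝ᵥ a i)) / m +
        2 * (u ⬝ᵥ v - (x ⬝ᵥ u) * (x ⬝ᵥ v)) := by
  rw [Matrix.add_mulVec, add_dotProduct, Matrix.smul_mulVec, smul_dotProduct, complProj,
    Matrix.sub_mulVec, Matrix.one_mulVec, sub_dotProduct, Matrix.vecMulVec_mulVec, certificate,
    Matrix.sum_mulVec, sum_dotProduct, Finset.sum_div]
  congr 1
  · refine Finset.sum_congr rfl fun i _ => ?_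
    rw [Matrix.smul_mulVec, smul_dotProduct, Matrix.vecMulVec_mulVec]
    simp only [smul_dotProduct, smul_eq_mul,
      MulOpposite.smul_eq_mul_unop, MulOpposite.unop_op]
    rw [dotProduct_comm (a i) u, dotProduct_comm (a i) v]
    ring
  · simp only [smul_dotProduct, smul_eq_mul,
      MulOpposite.smul_eq_mul_unop, MulOpposite.unop_op]
    ring

/-- Pairwise control on a net of the deviation of the weighted sums yields a dual certificate. -/
theorem isDualCertificate_certificate {n m : ℕ} (hm : 0 < m) {x₀ x : Fin n → ℝ} {r s : ℝ}
    (hr : x₀ = r • x) (hs : x = s • x₀) (hx : (x ⬝ᵥ x) • x = x) (hx1 : ∑ l, x l ^ 2 ≤ 1)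
    {N : Finset (EuclideanSpace ℝ (Fin n))}
    (hN : ∀ y : EuclideanSpace ℝ (Fin n), ‖y‖ ≤ 1 → ∃ u ∈ N, ‖y - u‖ ≤ 1 / 2)
    {e : (Fin n → ℝ) → (Fin n → ℝ) → ℝ} {t : ℝ}
    (he : ∀ u ∈ N, ∀ v ∈ N,
      |e u.ofLp v.ofLp + 2 * (u.ofLp ⬝ᵥ v.ofLp - (x ⬝ᵥ u.ofLp) * (x ⬝ᵥ v.ofLp))| ≤ t)
    {a : Fin m → Fin n → ℝ}
    (ha : ∀ u ∈ N, ∀ v ∈ N, |∑ i, (certificateWeight x (a i) * (u.ofLp ⬝ᵥ a i) * (v.ofLp ⬝ᵥ a i)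
      - e u.ofLp v.ofLp)| ≤ m * t) {εperp εT : ℝ} (h1 : 8 * t ≤ εperp) (h2 : 24 * t ≤ εT) :
    IsDualCertificate a x₀ 4 εperp εT (certificate x a) := by
  have hm' : (0 : ℝ) < m := by exact_mod_cast hm
  -- Bias and fluctuation contribute `t` each on the net, and the net argument multiplies the sum by
  -- `4`.
  have hspec : spectralNorm₂ (certificate x a + (2 : ℝ) • complProj x) ≤ 8 * t := by
    have := opNorm_le_of_half_net hN (Matrix.toEuclideanCLM (n := Fin n) (𝕜 := ℝ)
      (certificate x a + (2 : ℝ) • complProj x)) (δ := 2 * t) fun u hu v hv => ?_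
    · unfold spectralNorm₂
      linarith
    rw [inner_toEuclideanCLM, certificate_add_mulVec_dotProduct]
    have h3 := he u hu v hv
    have h4 := ha u hu v hv
    rw [Finset.sum_sub_distrib, Finset.sum_const, Finset.card_univ, Fintype.card_fin,
      nsmul_eq_mul] at h4
    set W := ∑ i, certificateWeight x (a i) * (u.ofLp ⬝ᵥ a i) * (v.ofLp ⬝ᵥ a i)
    have h5 : |W / m - e u.ofLp v.ofLp| ≤ t := by
      rw [show W / m - e u.ofLp v.ofLp = (W - m * e u.ofLp v.ofLp) / m by field_simp,
        abs_div, abs_of_pos hm', div_le_iff₀ hm', mul_comm t]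
      exact h4
    rw [abs_le] at h3 h5 ⊢
    constructor <;> linarith
  have hxn : ‖WithLp.toLp 2 x‖ ≤ 1 := by
    rw [EuclideanSpace.norm_eq, Real.sqrt_le_one]
    simpa using hx1
  obtain ⟨h3, h4⟩ := certificate_bounds_of_spectralNorm₂_le hr hs hx hxn
    (transpose_certificate x a) hspec
  refine ⟨⟨fun i => certificateWeight x (a i) / m, ?_, ?_⟩, h3.trans h1, h4.trans (by linarith)⟩
  · rw [pi_norm_le_iff_of_nonneg (by positivity)]
    intro i
    rw [Real.norm_eq_abs, abs_div, abs_of_pos hm']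
    gcongr
    exact abs_certificateWeight_le hx1 _
  · rw [adjoint_samplingOp, certificate]

/-! ### Choice of constants and the union bound -/

theorem mainTheorem7 (D : Measure ℝ) [IsProbabilityMeasure D]
    (hsub : ∃ L : ℝ, IsSubgaussianWith D L)
    (hmean : ∫ t, t ∂D = 0) (hvar : ∫ t, t ^ 2 ∂D = 1)
    (εperp εT : ℝ) (hεperp : 0 < εperp ∧ εperp ≤ 1) (hεT : 0 < εT ∧ εT ≤ 1) :
    ∃ μ κ₀ c B₀ : ℝ, 0 < μ ∧ μ < 1 ∧ 1 < κ₀ ∧ 0 < c ∧ 0 < B₀ ∧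
      ∃ n₀ : ℕ, ∀ n : ℕ, n₀ ≤ n → ∀ m : ℕ, κ₀ * n ≤ m →
        ∀ x₀ : Fin n → ℝ, IsFlat μ x₀ →
          1 - Real.exp (-c * m) ≤
            (measurementLaw D n m).real
              {a | ∃ Y : Matrix (Fin n) (Fin n) ℝ, IsDualCertificate a x₀ B₀ εperp εT Y} := by
  obtain ⟨L, hL⟩ := hsub
  obtain ⟨K, hK, hD⟩ := hL.exists_hasSubgaussianMGF hmean
  -- The spectral error will be `8 t`, and the tangential part at most three times that.
  set t := min (εperp / 8) (εT / 24) with ht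
  have ht0 : 0 < t := lt_min (by linarith [hεperp.1]) (by linarith [hεT.1])
  have ht1 : 8 * t ≤ εperp := by linarith [min_le_left (εperp / 8) (εT / 24)]
  have ht2 : 24 * t ≤ εT := by linarith [min_le_right (εperp / 8) (εT / 24)]
  obtain ⟨c, hc, hconc⟩ := exists_rate_weighted_bilinear hK hD (B := 4) (by norm_num) ht0
  set C := 2 * (3 * ((∫ y, |y| ^ 3 * Real.exp |y| ∂D) + 1) + 1) with hC
  have hC0 : 0 < C := by
    have : 0 ≤ ∫ y, |y| ^ 3 * Real.exp |y| ∂D := integral_nonneg fun y => by positivity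
    positivity
  have hlog : 0 < Real.log 50 := Real.log_pos (by norm_num)
  -- `μ` makes the bias at most `t`. `κ₀` gives `n log 50 ≤ (c/2) m`, where `50 = 5 · 5 · 2` pays
  -- for two net points and the factor `2 ≤ 2 ^ n`, which needs `n ≥ 1`. The summand `2` secures `κ₀
  -- > 1`.
  refine ⟨min (1 / 2) (t / (4 * C)), 2 * Real.log 50 / c + 2, c / 2, 4,
    lt_min (by norm_num) (by positivity), (min_le_left _ _).trans_lt (by norm_num), ?_,
    by positivity, by norm_num, 1, ?_⟩
  · have : 0 < 2 * Real.log 50 / c := by positivity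
    linarith
  intro n hn m hm x₀ hflat
  set μ := min (1 / 2) (t / (4 * C)) with hμ
  have hμ0 : 0 < μ := lt_min (by norm_num) (by positivity)
  have hμ1 : μ ≤ 1 := (min_le_left _ _).trans (by norm_num)
  have hμC : 4 * (C * μ) ≤ t := by
    have : μ ≤ t / (4 * C) := min_le_right _ _
    rw [le_div_iff₀ (by positivity)] at this
    linarith
  have hn1 : (1 : ℝ) ≤ n := by exact_mod_cast hn
  have hmlog : 2 * Real.log 50 / c * n ≤ m := by
    refine le_trans ?_ hm
    gcongr
    linarith
  have hm0 : 0 < m := by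
    have h1 : 0 < 2 * Real.log 50 / c := by positivity
    have : (0 : ℝ) < m := lt_of_lt_of_le (by positivity) hmlog
    exact_mod_cast this
  set ν := ‖WithLp.toLp 2 x₀‖ with hν
  have hν0 : 0 ≤ ν := norm_nonneg _
  have hνsq : x₀ ⬝ᵥ x₀ = ν ^ 2 := by
    rw [hν, ← real_inner_self_eq_norm_sq, EuclideanSpace.inner_toLp_toLp, star_trivial]
  obtain ⟨x, hr, hs, hxx, hx1, hxμ⟩ : ∃ x : Fin n → ℝ, x₀ = ν • x ∧ x = ν⁻¹ • x₀ ∧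
      (x ⬝ᵥ x) • x = x ∧ ∑ l, x l ^ 2 ≤ 1 ∧ ∀ l, |x l| ≤ μ := by
    have hsum : ∑ l, (ν⁻¹ • x₀) l ^ 2 = (ν⁻¹ • x₀) ⬝ᵥ (ν⁻¹ • x₀) :=
      Finset.sum_congr rfl fun l _ => sq _
    rcases hν0.eq_or_lt with h0 | hpos
    · have hx₀ : x₀ = 0 := by
        rw [← dotProduct_self_eq_zero, hνsq, ← h0]
        norm_num
      exact ⟨0, by simp [hx₀], by simp [hx₀], by simp, by simp, fun l => by simpa using hμ0.le⟩
    · have h1 : (ν⁻¹ • x₀) ⬝ᵥ (ν⁻¹ • x₀) = 1 := by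
        rw [smul_dotProduct, dotProduct_smul, hνsq, smul_eq_mul, smul_eq_mul]
        field_simp
      refine ⟨ν⁻¹ • x₀, ?_, rfl, by rw [h1, one_smul], by rw [hsum, h1], fun l => ?_⟩
      · rw [smul_smul, mul_inv_cancel₀ hpos.ne', one_smul]
      · rw [Pi.smul_apply, smul_eq_mul, abs_mul, abs_inv, abs_of_pos hpos, ← div_eq_inv_mul,
          div_le_iff₀ hpos]
        exact (norm_le_pi_norm x₀ l).trans hflat
  obtain ⟨N, hNc, hN1, hN⟩ := exists_half_net (EuclideanSpace ℝ (Fin n))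
  rw [finrank_euclideanSpace_fin] at hNc
  have hNsq : ∀ u ∈ N, ∑ j, u.ofLp j ^ 2 ≤ 1 := fun u hu => by
    rw [← EuclideanSpace.real_norm_sq_eq]
    exact pow_le_one₀ (norm_nonneg _) (hN1 u hu)
  set e : (Fin n → ℝ) → (Fin n → ℝ) → ℝ := fun u v =>
    ∫ b, certificateWeight x b * (u ⬝ᵥ b) * (v ⬝ᵥ b) ∂(Measure.pi fun _ => D) with he
  set bad : EuclideanSpace ℝ (Fin n) → EuclideanSpace ℝ (Fin n) → Set (Fin m → Fin n → ℝ) :=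
    fun u v => {a | m * t ≤ |∑ i, (certificateWeight x (a i) * (u.ofLp ⬝ᵥ a i) * (v.ofLp ⬝ᵥ a i)
      - e u.ofLp v.ofLp)|} with hbad
  set good := {a : Fin m → Fin n → ℝ | ∃ Y : Matrix (Fin n) (Fin n) ℝ,
    IsDualCertificate a x₀ 4 εperp εT Y} with hgood
  set P := measurementLaw D n m with hP
  -- Covering the whole space and using subadditivity avoids any measurability of `good`.
  have hcover : (Set.univ : Set (Fin m → Fin n → ℝ)) ⊆ good ∪ ⋃ u ∈ N, ⋃ v ∈ N, bad u v := by
    intro a _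
    by_cases hab : ∃ u ∈ N, ∃ v ∈ N, a ∈ bad u v
    · obtain ⟨u, hu, v, hv, h⟩ := hab
      right
      simp only [Set.mem_iUnion]
      exact ⟨u, hu, v, hv, h⟩
    · left
      push Not at hab
      refine ⟨certificate x a, isDualCertificate_certificate hm0 hr hs hxx hx1 hN (e := e)
        (fun u hu v hv => ?_) (fun u hu v hv => ?_) ht1 ht2⟩
      · exact (abs_integral_certificateWeight_add_le hD hmean hvar hx1 hxμ hμ0.le hμ1
          (hNsq u hu) (hNsq v hv)).trans hμC
      · exact (not_le.mp (hab u hu v hv)).le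
  have hbadle : P.real (⋃ u ∈ N, ⋃ v ∈ N, bad u v) ≤ Real.exp (-(c / 2) * m) := by
    have hone : ∀ u ∈ N, ∀ v ∈ N, P.real (bad u v) ≤ 2 * Real.exp (-c * m) :=
      fun u hu v hv => hconc n m (certificateWeight x) (measurable_certificateWeight x)
        (abs_certificateWeight_le hx1) u.ofLp v.ofLp (hNsq u hu) (hNsq v hv)
    have hN5 : (N.card : ℝ) ≤ 5 ^ n := by exact_mod_cast hNc
    calc P.real (⋃ u ∈ N, ⋃ v ∈ N, bad u v)
        ≤ ∑ u ∈ N, ∑ v ∈ N, P.real (bad u v) :=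
          (measureReal_biUnion_finset_le _ _).trans
            (Finset.sum_le_sum fun u _ => measureReal_biUnion_finset_le _ _)
      _ ≤ ∑ u ∈ N, ∑ v ∈ N, 2 * Real.exp (-c * m) :=
          Finset.sum_le_sum fun u hu => Finset.sum_le_sum fun v hv => hone u hu v hv
      _ = N.card * (N.card * (2 * Real.exp (-c * m))) := by
          rw [Finset.sum_const, Finset.sum_const, nsmul_eq_mul, nsmul_eq_mul]
      _ ≤ 5 ^ n * (5 ^ n * (2 ^ n * Real.exp (-c * m))) := by
          have h2n : (2 : ℝ) ≤ 2 ^ n := le_self_pow₀ one_le_two (Nat.one_le_iff_ne_zero.mp hn)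
          have hexp := (Real.exp_pos (-c * m)).le
          have h1 := mul_le_mul_of_nonneg_right h2n hexp
          have h2 := mul_le_mul hN5 h1 (mul_nonneg zero_le_two hexp) (pow_nonneg (by norm_num) n)
          exact mul_le_mul hN5 h2 (mul_nonneg (Nat.cast_nonneg _) (mul_nonneg zero_le_two hexp))
            (pow_nonneg (by norm_num) n)
      _ = Real.exp (n * Real.log 50) * Real.exp (-c * m) := by
          rw [Real.exp_nat_mul, Real.exp_log (by norm_num),
            show (50 : ℝ) ^ n = 5 ^ n * (5 ^ n * 2 ^ n) by rw [← mul_pow, ← mul_pow]; norm_num]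
          ring
      _ ≤ Real.exp (-(c / 2) * m) := by
          rw [← Real.exp_add, Real.exp_le_exp]
          rw [div_mul_eq_mul_div, div_le_iff₀ hc] at hmlog
          linarith
  have htot : 1 ≤ P.real good + P.real (⋃ u ∈ N, ⋃ v ∈ N, bad u v) := by
    rw [← probReal_univ (μ := P)]
    exact (measureReal_mono hcover).trans (measureReal_union_le _ _)
  linarith
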